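/- Let $K$ be a finite triangulation of a closed connected oriented surface $M$, with its vertices linearly ordered, and let $C^j(K)$ be the simplicial $j$-cochains with values in $\mathbb{C}$, with coboundary $\delta$. For $\sigma,\tau\in C^1(K)$ let $\sigma\cup\tau=R(W\sigma\wedge W\tau)\in C^2(K)$, where $W$ is the ($\mathbb{C}$-linear) Whitney map, sending the edge $[p,q]$ to the form $\mu_p\,d\mu_q-\mu_q\,d\mu_p$ in barycentric coordinates, and $R$ is integration over the triangles of $K$. Let $\langle\cdot,\cdot\rangle$ be a positive definite hermitian inner product on $\bigoplus_j C^j(K)$ (antilinear in the second argument) for which different degrees are orthogonal and which on $C^1(K)$ is the hermitian extension of a real inner product on the real $1$-cochains, i.e. $\langle\bar a,\bar b\rangle=\overline{\langle a,b\rangle}$ for $a,b\in C^1(K)$. Let $\delta^*$ be the adjoint of $\delta$, let $H^1=\{a\in C^1(K): (\delta^*\delta+\delta\delta^*)a=\delta a=\delta^*a=0\}$ be the space of harmonic $1$-cochains, let $\bigstar:C^1(K)\to C^1(K)$ be defined by $\langle\bigstar a,b\rangle=(a\cup\bar b)[M]$, and let $\bigstar_H:H^1\to H^1$ be the induced operator,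 i.e. $\bigstar$ followed by the orthogonal projection onto $H^1$. The space $\mathcal{H}^{1,0}$ of holomorphic $1$-cochains is the linear span of all $\sigma\in H^1$ with $\bigstar_H\sigma=-i\lambda\sigma$ for some real $\lambda\ge 0$. Let $a_1,\dots,a_g,b_1,\dots,b_g$ be integral simplicial $1$-cycles of $K$ whose classes form a canonical basis of $H_1(K;\mathbb{Z})$, i.e. a basis with intersection numbers $a_i\cdot b_j=\delta_{ij}$ and $a_i\cdot a_j=b_i\cdot b_j=0$. (Here $c\cdot c'=(\eta_c\cup\eta_{c'})[M]$, where the closed $1$-cochain $\eta_c$ is Poincaré dual to the cycle $c$: $\alpha(c)=(\alpha\cup\eta_c)[M]$ for every closed $1$-cochain $\alpha$.) Then there is a unique basis $\sigma_1,\dots,\sigma_g$ of $\mathcal{H}^{1,0}$ with $\sigma_i(a_j)=\delta_{ij}$ (the canonical basis), and the combinatorial period matrix $\Pi=(\sigma_i(b_j))_{1\le i,j\le g}$ is symmetric with positive definite imaginary part $\operatorname{Im}\Pi$. -/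

import Mathlib

open scoped ComplexConjugate

noncomputable section

/-! ### Simplices, chains, cochains -/

/-- The `j`-simplices of an abstract simplicial complex. The vertices are linearly ordered, and
every simplex carries the orientation given by its vertices in increasing order. -/
def Simplex {V : Type*} (K : AbstractSimplicialComplex V) (j : ℕ) : Type _ :=
  {s : Finset V // s ∈ K.faces ∧ s.card = j + 1}

instance {V : Type*} (K : AbstractSimplicialComplex V) (j : ℕ) : DecidableEq (Simplex K j) :=
  Classical.decEq _

instance {V : Type*} [Fintype V] (K : AbstractSimplicialComplex V) (j : ℕ) :
    Fintype (Simplex K j) :=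
  letI : Finite (Simplex K j) := Subtype.finite
  Fintype.ofFinite _

/-- The face `[p₀, …, p̂ᵢ, …, p_{j+1}]` of the simplex `[p₀, …, p_{j+1}]`, `p₀ < ⋯ < p_{j+1}`. -/
def Simplex.face {V : Type*} [LinearOrder V] {K : AbstractSimplicialComplex V} {j : ℕ}
    (s : Simplex K (j + 1)) (i : Fin (j + 2)) : Simplex K j :=
  ⟨s.1.erase (s.1.orderEmbOfFin s.2.2 i), by
    have hmem := s.1.orderEmbOfFin_mem s.2.2 i
    have hc : (s.1.erase (s.1.orderEmbOfFin s.2.2 i)).card = j + 1 := by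
      rw [Finset.card_erase_of_mem hmem, s.2.2]; rfl
    exact ⟨(K.isRelLowerSet_faces s.2.1).2 (Finset.erase_subset _ _)
      (Finset.card_pos.mp (by omega)), hc⟩⟩

/-- Simplicial cochains of degree `j` with complex values. -/
abbrev Cochain {V : Type*} (K : AbstractSimplicialComplex V) (j : ℕ) : Type _ :=
  Simplex K j → ℂ

/-- Simplicial chains of degree `j` with integer coefficients. -/
abbrev Chain {V : Type*} (K : AbstractSimplicialComplex V) (j : ℕ) : Type _ :=
  Simplex K j → ℤ

section Surface

variable {V : Type*} [Fintype V] [LinearOrder V]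

/-- The simplicial coboundary `δ : C^j → C^{j+1}`. -/
def coboundary (K : AbstractSimplicialComplex V) (j : ℕ) :
    Cochain K j →ₗ[ℂ] Cochain K (j + 1) where
  toFun f s := ∑ i : Fin (j + 2), (-1 : ℂ) ^ (i : ℕ) * f (s.face i)
  map_add' f g := by
    funext s; simp [mul_add, Finset.sum_add_distrib]
  map_smul' r f := by
    funext s; simp [Finset.mul_sum, mul_left_comm]

/-- The simplicial boundary `∂ : C_{j+1} → C_j`; the coefficient of `∂ c` at `s` collects the
simplices `t` having `s` as a face. -/
def boundary (K : AbstractSimplicialComplex V) (j : ℕ) :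
    Chain K (j + 1) →ₗ[ℤ] Chain K j where
  toFun c s := ∑ t : Simplex K (j + 1), ∑ i : Fin (j + 2),
    if t.face i = s then (-1 : ℤ) ^ (i : ℕ) * c t else 0
  map_add' c d := by
    funext s
    simp only [Pi.add_apply, ← Finset.sum_add_distrib]
    refine Finset.sum_congr rfl fun t _ => Finset.sum_congr rfl fun i _ => ?_
    split_ifs <;> ring
  map_smul' r c := by
    funext s
    simp only [Pi.smul_apply, smul_eq_mul, eq_intCast, Int.cast_id, Finset.mul_sum]
    refine Finset.sum_congr rfl fun t _ => Finset.sum_congr rfl fun i _ => ?_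
    split_ifs <;> ring

/-- The value `f(c)` of a cochain on a chain. -/
def Cochain.eval {K : AbstractSimplicialComplex V} {j : ℕ} (f : Cochain K j) (c : Chain K j) : ℂ :=
  ∑ s : Simplex K j, (c s : ℂ) * f s

/-! ### Triangulated closed oriented surfaces -/

/-- The `1`-skeleton of a complex. -/
def oneSkeleton (K : AbstractSimplicialComplex V) : SimpleGraph V where
  Adj u v := u ≠ v ∧ ({u, v} : Finset V) ∈ K.faces
  symm := ⟨fun u v h => ⟨h.1.symm, by rw [Finset.pair_comm]; exact h.2⟩⟩
  loopless := ⟨fun _ h => h.1 rfl⟩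

/-- The `1`-skeleton of the link of the vertex `v`: its vertices are the neighbours `w` of `v`,
and `w`, `w'` are joined when `v`, `w`, `w'` span a triangle. -/
def linkGraph (K : AbstractSimplicialComplex V) (v : V) :
    SimpleGraph {w : V // v ≠ w ∧ ({v, w} : Finset V) ∈ K.faces} where
  Adj w w' := w ≠ w' ∧ ({v, w.1, w'.1} : Finset V) ∈ K.faces
  symm := ⟨fun w w' h => ⟨h.1.symm, by rw [Finset.pair_comm]; exact h.2⟩⟩
  loopless := ⟨fun _ h => h.1 rfl⟩

variable (V) in
/-- A triangulated closed (connected, oriented) surface: a finite connected simplicial complex of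
dimension at most two in which the link of every vertex is a cycle (a connected graph with all
degrees two), with an orientation, i.e. a fundamental cycle `[M]` in which every triangle has
coefficient `1` or `-1`. -/
structure TriangulatedSurface where
  /-- the underlying simplicial complex -/
  K : AbstractSimplicialComplex V
  card_le_three : ∀ s ∈ K.faces, s.card ≤ 3
  connected : (oneSkeleton K).Connected
  link_connected : ∀ v, (linkGraph K v).Connected
  link_degree : ∀ v w, ((linkGraph K v).neighborSet w).ncard = 2
  /-- the fundamental cycle -/
  fundamentalCycle : Chain K 2
  fundamentalCycle_coeff : ∀ t, fundamentalCycle t = 1 ∨ fundamentalCycle t = -1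
  boundary_fundamentalCycle : boundary K 1 fundamentalCycle = 0

/-! ### The cochain product induced by Whitney forms -/

/-- Barycentric coordinates `μ₀, μ₁, μ₂` on the standard triangle `0 ≤ x, 0 ≤ y, x + y ≤ 1`. -/
def bary (i : Fin 3) (x y : ℝ) : ℝ := ![1 - x - y, x, y] i

/-- The coefficients of the constant `1`-form `dμᵢ` in the basis `dx, dy`. -/
def dbary (i : Fin 3) (k : Fin 2) : ℝ := ![![-1, -1], ![1, 0], ![0, 1]] i k

/-- The coefficients at `(x, y)` of the elementary Whitney form `μᵢ dμⱼ - μⱼ dμᵢ` of the edge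
`[pᵢ, pⱼ]` of a triangle. -/
def whitneyEdge (i j : Fin 3) (x y : ℝ) (k : Fin 2) : ℝ :=
  bary i x y * dbary j k - bary j x y * dbary i k

/-- The coefficients of the Whitney form `W σ` on the triangle `t = [p₀, p₁, p₂]`, `p₀ < p₁ < p₂`,
which is parametrized affinely by the standard triangle. The edge opposite to `pᵢ` is `t.face i`;
the elementary forms of all other edges vanish on `t`. -/
def whitneyForm {K : AbstractSimplicialComplex V} (σ : Cochain K 1) (t : Simplex K 2)
    (x y : ℝ) (k : Fin 2) : ℂ :=
  σ (t.face 2) * whitneyEdge 0 1 x y k + σ (t.face 1) * whitneyEdge 0 2 x y k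
    + σ (t.face 0) * whitneyEdge 1 2 x y k

/-- The cochain product `σ ∪ τ = R (W σ ∧ W τ)` of two `1`-cochains, where `R` integrates
`2`-forms over the triangles `[p₀, p₁, p₂]`; it is complex bilinear. -/
def cup {K : AbstractSimplicialComplex V} (σ τ : Cochain K 1) : Cochain K 2 := fun t =>
  ∫ x in (0 : ℝ)..1, ∫ y in (0 : ℝ)..(1 - x),
    (whitneyForm σ t x y 0 * whitneyForm τ t x y 1 - whitneyForm σ t x y 1 * whitneyForm τ t x y 0)

/-- The integral of an affine function over an interval. -/
theorem integral_affine (P Q : ℂ) (a : ℝ) :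
    (∫ y in (0 : ℝ)..a, (P + Q * (y : ℂ))) = P * a + Q * (a : ℂ) ^ 2 / 2 := by
  have h : ∀ y ∈ Set.uIcc (0 : ℝ) a,
      HasDerivAt (fun y : ℝ => P * (y : ℂ) + Q * (y : ℂ) ^ 2 / 2) (P + Q * (y : ℂ)) y := by
    intro y _
    have h1 : HasDerivAt (fun z : ℂ => P * z + Q * z ^ 2 / 2) (P + Q * (y : ℂ)) (y : ℂ) := by
      have := ((hasDerivAt_id (y : ℂ)).const_mul P).add
        ((((hasDerivAt_id (y : ℂ)).pow 2).const_mul Q).div_const 2)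
      refine this.congr_deriv ?_
      simp only [id_eq, Nat.cast_ofNat]
      norm_num
      ring
    exact h1.comp_ofReal
  rw [intervalIntegral.integral_eq_sub_of_hasDerivAt h
    (Continuous.intervalIntegrable (by fun_prop) _ _)]
  simp

/-- The integral of a quadratic function over the unit interval. -/
theorem integral_quadratic (P Q R : ℂ) :
    (∫ y in (0 : ℝ)..1, (P + Q * (y : ℂ) + R * (y : ℂ) ^ 2)) = P + Q / 2 + R / 3 := by
  have h : ∀ y ∈ Set.uIcc (0 : ℝ) 1,
      HasDerivAt (fun y : ℝ => P * (y : ℂ) + Q * (y : ℂ) ^ 2 / 2 + R * (y : ℂ) ^ 3 / 3)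
        (P + Q * (y : ℂ) + R * (y : ℂ) ^ 2) y := by
    intro y _
    have h1 : HasDerivAt (fun z : ℂ => P * z + Q * z ^ 2 / 2 + R * z ^ 3 / 3)
        (P + Q * (y : ℂ) + R * (y : ℂ) ^ 2) (y : ℂ) := by
      have := (((hasDerivAt_id (y : ℂ)).const_mul P).add
        ((((hasDerivAt_id (y : ℂ)).pow 2).const_mul Q).div_const 2)).add
        ((((hasDerivAt_id (y : ℂ)).pow 3).const_mul R).div_const 3)
      refine this.congr_deriv ?_
      simp only [id_eq, Nat.cast_ofNat]
      norm_num
      ring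
    exact h1.comp_ofReal
  rw [intervalIntegral.integral_eq_sub_of_hasDerivAt h
    (Continuous.intervalIntegrable (by fun_prop) _ _)]
  simp

/-- Evaluation of the integral defining `cup`. -/
theorem cup_apply {K : AbstractSimplicialComplex V} (σ τ : Cochain K 1) (t : Simplex K 2) :
    cup σ τ t = (1 / 6 : ℂ) *
      ((σ (t.face 2) * τ (t.face 0) - σ (t.face 0) * τ (t.face 2))
        + (σ (t.face 2) * τ (t.face 1) - σ (t.face 1) * τ (t.face 2))
        + (σ (t.face 1) * τ (t.face 0) - σ (t.face 0) * τ (t.face 1))) := by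
  set s₂ := σ (t.face 2) with hs₂
  set s₁ := σ (t.face 1) with hs₁
  set s₀ := σ (t.face 0) with hs₀
  set r₂ := τ (t.face 2) with hr₂
  set r₁ := τ (t.face 1) with hr₁
  set r₀ := τ (t.face 0) with hr₀
  set A : ℂ := s₂ * r₁ - s₁ * r₂ with hA
  set B : ℂ := s₂ * r₀ - s₀ * r₂ with hB
  set C : ℂ := s₁ * r₀ - s₀ * r₁ with hC
  have key : ∀ x y : ℝ, whitneyForm σ t x y 0 * whitneyForm τ t x y 1
      - whitneyForm σ t x y 1 * whitneyForm τ t x y 0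
      = (A + (B - A) * (x : ℂ)) + (C - A) * (y : ℂ) := by
    intro x y
    simp only [whitneyForm, whitneyEdge, bary, dbary, ← hs₂, ← hs₁, ← hs₀, ← hr₂, ← hr₁, ← hr₀,
      hA, hB, hC]
    simp
    ring
  have hquad : ∀ x : ℝ, (A + (B - A) * (x : ℂ)) * ((1 - x : ℝ) : ℂ)
      + (C - A) * ((1 - x : ℝ) : ℂ) ^ 2 / 2
      = (A + (C - A) / 2) + (B - A - C) * (x : ℂ) + ((C + A) / 2 - B) * (x : ℂ) ^ 2 := by
    intro x
    push_cast
    ring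
  simp only [cup, key, integral_affine, hquad, integral_quadratic]
  ring

/-- The cochain product is linear in the first factor. -/
theorem cup_add_left {K : AbstractSimplicialComplex V} (σ σ' τ : Cochain K 1) :
    cup (σ + σ') τ = cup σ τ + cup σ' τ := by
  funext t; simp only [cup_apply, Pi.add_apply]; ring

theorem cup_smul_left {K : AbstractSimplicialComplex V} (r : ℂ) (σ τ : Cochain K 1) :
    cup (r • σ) τ = r • cup σ τ := by
  funext t; simp only [cup_apply, Pi.smul_apply, smul_eq_mul]; ring

theorem cup_add_right {K : AbstractSimplicialComplex V} (σ τ τ' : Cochain K 1) :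
    cup σ (τ + τ') = cup σ τ + cup σ τ' := by
  funext t; simp only [cup_apply, Pi.add_apply]; ring

theorem cup_smul_right {K : AbstractSimplicialComplex V} (r : ℂ) (σ τ : Cochain K 1) :
    cup σ (r • τ) = r • cup σ τ := by
  funext t; simp only [cup_apply, Pi.smul_apply, smul_eq_mul]; ring

theorem Cochain.eval_add {K : AbstractSimplicialComplex V} {j : ℕ} (f g : Cochain K j)
    (c : Chain K j) : (f + g).eval c = f.eval c + g.eval c := by
  simp [Cochain.eval, mul_add, Finset.sum_add_distrib]

theorem Cochain.eval_smul {K : AbstractSimplicialComplex V} {j : ℕ} (r : ℂ) (f : Cochain K j)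
    (c : Chain K j) : (r • f).eval c = r * f.eval c := by
  simp [Cochain.eval, Finset.mul_sum, mul_left_comm]

/-! ### Hermitian inner products on cochains and the induced operators -/

/-- The antilinear functionals on a complex vector space. -/
abbrev AntiDual (E : Type*) [AddCommGroup E] [Module ℂ E] : Type _ := E →ₗ⋆[ℂ] ℂ

/-- Riesz representation for a positive definite hermitian form, linear in the first argument and
antilinear in the second one, on a finite-dimensional complex vector space. -/
theorem riesz_bijective {E : Type*} [AddCommGroup E] [Module ℂ E] [FiniteDimensional ℂ E]
    (B : E →ₗ[ℂ] AntiDual E) (hsymm : ∀ a b, conj (B b a) = B a b)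
    (hpos : ∀ a, a ≠ 0 → 0 < (B a a).re) : Function.Bijective B := by
  constructor
  · refine (injective_iff_map_eq_zero B).2 fun a ha => ?_
    by_contra hne
    have := hpos a hne
    rw [ha] at this
    simp at this
  · let core : InnerProductSpace.Core ℂ E :=
      { inner := fun x y => B y x
        conj_inner_symm := fun x y => hsymm y x
        re_inner_nonneg := fun x => by
          by_cases hx : x = 0
          · simp [hx]
          · exact (hpos x hx).le
        add_left := fun x y z => by simp
        smul_left := fun x y r => by simp
        definite := fun x hx => by
          by_contra hne
          have h := hpos x hne
          have hx' : B x x = 0 := hx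
          simp [hx'] at h }
    let _ : NormedAddCommGroup E := core.toNormedAddCommGroup
    let _ : InnerProductSpace ℂ E := InnerProductSpace.ofCore core.toCore
    have : CompleteSpace E := FiniteDimensional.complete ℂ E
    intro ψ
    let φ : E →ₗ[ℂ] ℂ :=
      { toFun := fun b => conj (ψ b)
        map_add' := fun x y => by simp
        map_smul' := fun r x => by simp }
    refine ⟨(InnerProductSpace.toDual ℂ E).symm (LinearMap.toContinuousLinearMap φ), ?_⟩
    ext b
    have h := InnerProductSpace.toDual_symm_apply (𝕜 := ℂ) (E := E) (x := b)
      (y := LinearMap.toContinuousLinearMap φ)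
    have h2 : B b ((InnerProductSpace.toDual ℂ E).symm (LinearMap.toContinuousLinearMap φ))
        = conj (ψ b) := h
    rw [← hsymm, h2]
    simp

/-- A positive definite hermitian inner product on the complex simplicial cochains for which
cochains of different degrees are orthogonal, that is, one inner product in every degree `j`. As in
the convention `⟨★ a, b⟩ = (a ∪ b̄)[M]`, it is linear in the first argument and antilinear in the
second one. -/
structure CochainInnerProduct (K : AbstractSimplicialComplex V) where
  /-- the inner product `⟨a, b⟩` of cochains of degree `j` -/
  form : ∀ j : ℕ, Cochain K j →ₗ[ℂ] AntiDual (Cochain K j)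
  conj_symm : ∀ j a b, conj (form j b a) = form j a b
  pos : ∀ j a, a ≠ 0 → 0 < (form j a a).re

namespace CochainInnerProduct

variable {K : AbstractSimplicialComplex V} (ip : CochainInnerProduct K)

/-- The inner product on `1`-cochains is compatible with complex conjugation, `⟨ā, b̄⟩ = conj ⟨a, b⟩`:
it is the hermitian extension of a real inner product on the real `1`-cochains. -/
def IsReal : Prop := ∀ a b : Cochain K 1, ip.form 1 (star a) (star b) = conj (ip.form 1 a b)

/-- The isomorphism `a ↦ ⟨a, ·⟩`. -/
def riesz (j : ℕ) : Cochain K j ≃ₗ[ℂ] AntiDual (Cochain K j) :=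
  LinearEquiv.ofBijective (ip.form j) (riesz_bijective _ (ip.conj_symm j) (ip.pos j))

theorem form_riesz_symm (j : ℕ) (ψ : AntiDual (Cochain K j)) (b : Cochain K j) :
    ip.form j ((ip.riesz j).symm ψ) b = ψ b :=
  congrArg (fun f : AntiDual (Cochain K j) => f b) ((ip.riesz j).apply_symm_apply ψ)

/-- The adjoint `δ* : C^{j+1} → C^j` of the coboundary. -/
def codifferential (j : ℕ) : Cochain K (j + 1) →ₗ[ℂ] Cochain K j :=
  (ip.riesz j).symm.toLinearMap ∘ₗ
    { toFun := fun a => (ip.form (j + 1) a).comp (coboundary K j)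
      map_add' := fun a b => by ext; simp
      map_smul' := fun r a => by ext; simp }

/-- The defining property `⟨δ* a, b⟩ = ⟨a, δ b⟩`. -/
theorem form_codifferential (j : ℕ) (a : Cochain K (j + 1)) (b : Cochain K j) :
    ip.form j (ip.codifferential j a) b = ip.form (j + 1) a (coboundary K j b) :=
  ip.form_riesz_symm j _ b

/-- The combinatorial Laplacian `δ* δ + δ δ*` in degree `j + 1`. -/
def laplacian (j : ℕ) : Cochain K (j + 1) →ₗ[ℂ] Cochain K (j + 1) :=
  ip.codifferential (j + 1) ∘ₗ coboundary K (j + 1) + coboundary K j ∘ₗ ip.codifferential j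

/-- The space `H¹` of harmonic `1`-cochains. -/
def harmonic : Submodule ℂ (Cochain K 1) :=
  LinearMap.ker (ip.laplacian 0) ⊓ LinearMap.ker (coboundary K 1)
    ⊓ LinearMap.ker (ip.codifferential 0)

/-- The inner product restricted to the harmonic `1`-cochains. -/
def harmonicForm : ip.harmonic →ₗ[ℂ] AntiDual ip.harmonic where
  toFun a := (ip.form 1 (a : Cochain K 1)).comp ip.harmonic.subtype
  map_add' a b := by ext; simp
  map_smul' r a := by ext; simp

theorem harmonicForm_bijective : Function.Bijective ip.harmonicForm :=
  riesz_bijective _ (fun a b => ip.conj_symm 1 a b)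
    (fun a ha => ip.pos 1 a (fun h => ha (Subtype.ext h)))

/-- The orthogonal projection of the `1`-cochains onto the harmonic `1`-cochains. -/
def harmonicProjection : Cochain K 1 →ₗ[ℂ] ip.harmonic :=
  (LinearEquiv.ofBijective ip.harmonicForm ip.harmonicForm_bijective).symm.toLinearMap ∘ₗ
    { toFun := fun a => (ip.form 1 a).comp ip.harmonic.subtype
      map_add' := fun a b => by ext; simp
      map_smul' := fun r a => by ext; simp }

/-- The defining property of the orthogonal projection. -/
theorem form_harmonicProjection (a : Cochain K 1) (b : ip.harmonic) :
    ip.form 1 (ip.harmonicProjection a : Cochain K 1) (b : Cochain K 1) = ip.form 1 a b :=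
  congrArg (fun f : AntiDual ip.harmonic => f b)
    ((LinearEquiv.ofBijective ip.harmonicForm ip.harmonicForm_bijective).apply_symm_apply
      ((ip.form 1 a).comp ip.harmonic.subtype))

end CochainInnerProduct

/-! ### The combinatorial star operator and holomorphic cochains -/

section Star

variable (S : TriangulatedSurface V) (ip : CochainInnerProduct S.K)

/-- The combinatorial star operator on `1`-cochains, `⟨★ a, b⟩ = (a ∪ b̄)[M]`. -/
def combinatorialStar : Cochain S.K 1 →ₗ[ℂ] Cochain S.K 1 :=
  (ip.riesz 1).symm.toLinearMap ∘ₗ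
    { toFun := fun a =>
        { toFun := fun b => (cup a (star b)).eval S.fundamentalCycle
          map_add' := fun b b' => by rw [star_add, cup_add_right, Cochain.eval_add]
          map_smul' := fun r b => by
            rw [star_smul, cup_smul_right, Cochain.eval_smul]; rfl }
      map_add' := fun a a' => by
        ext b
        simp [cup_add_left, Cochain.eval_add]
      map_smul' := fun r a => by
        ext b
        simp [cup_smul_left, Cochain.eval_smul] }

/-- The defining property of the combinatorial star operator. -/
theorem form_combinatorialStar (a b : Cochain S.K 1) :
    ip.form 1 (combinatorialStar S ip a) b = (cup a (star b)).eval S.fundamentalCycle :=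
  ip.form_riesz_symm 1 _ b

/-- The operator induced by `★` on the harmonic `1`-cochains: `★` followed by the orthogonal
projection. (On the cochain level `★` need not preserve harmonic cochains.) -/
def harmonicStar : ip.harmonic →ₗ[ℂ] ip.harmonic :=
  ip.harmonicProjection ∘ₗ combinatorialStar S ip ∘ₗ ip.harmonic.subtype

/-- The space of holomorphic `1`-cochains, spanned by the harmonic `σ` with `★ σ = -i λ σ` for some
real `λ ≥ 0`, where `★` is the induced operator on harmonic cochains. -/
def holomorphicCochains : Submodule ℂ (Cochain S.K 1) :=
  Submodule.span ℂ {σ | ∃ (h : σ ∈ ip.harmonic) (l : ℝ), 0 ≤ l ∧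
    (harmonicStar S ip ⟨σ, h⟩ : Cochain S.K 1) = (-(Complex.I * l)) • σ}

/-! ### Canonical homology bases and periods -/

/-- The classes of the chains `c k` form a basis of the homology group `H₁(K; ℤ)`: they are cycles,
and every cycle is homologous to exactly one integral linear combination of them. -/
def IsHomologyBasis (K : AbstractSimplicialComplex V) {ι : Type*} [Fintype ι]
    (c : ι → Chain K 1) : Prop :=
  (∀ k, boundary K 0 (c k) = 0) ∧
    ∀ z : Chain K 1, boundary K 0 z = 0 →
      ∃! n : ι → ℤ, ∃ d : Chain K 2, z - ∑ k, n k • c k = boundary K 1 d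

/-- The closed `1`-cochain `η` is Poincaré dual to the `1`-cycle `c`: `α(c) = (α ∪ η)[M]` for every
closed `1`-cochain `α`. (Such an `η` exists for every cycle, and it is unique up to coboundaries.) -/
def IsPoincareDual (η : Cochain S.K 1) (c : Chain S.K 1) : Prop :=
  coboundary S.K 1 η = 0 ∧
    ∀ α : Cochain S.K 1, coboundary S.K 1 α = 0 →
      α.eval c = (cup α η).eval S.fundamentalCycle

/-- The `1`-cycles `c`, `c'` have algebraic intersection number `c · c' = n`, computed as
`(η_c ∪ η_{c'})[M]` from Poincaré duals of `c` and `c'`. -/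
def HasIntersectionNumber (c c' : Chain S.K 1) (n : ℤ) : Prop :=
  ∀ η η' : Cochain S.K 1, IsPoincareDual S η c → IsPoincareDual S η' c' →
    (cup η η').eval S.fundamentalCycle = n

/-- A canonical homology basis `a₁, …, a_g, b₁, …, b_g`, represented by simplicial cycles: a basis
of `H₁(K; ℤ)` with `aᵢ · bⱼ = δᵢⱼ` and `aᵢ · aⱼ = bᵢ · bⱼ = 0`. -/
structure IsCanonicalHomologyBasis {g : ℕ} (a b : Fin g → Chain S.K 1) : Prop where
  isHomologyBasis : IsHomologyBasis S.K (Sum.elim a b)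
  inter_ab : ∀ i j, HasIntersectionNumber S (a i) (b j) (if i = j then 1 else 0)
  inter_aa : ∀ i j, HasIntersectionNumber S (a i) (a j) 0
  inter_bb : ∀ i j, HasIntersectionNumber S (b i) (b j) 0

/-- The canonical basis of the holomorphic `1`-cochains: a basis with `σᵢ(aⱼ) = δᵢⱼ`. -/
structure IsCanonicalHolomorphicBasis {g : ℕ} (a : Fin g → Chain S.K 1)
    (σ : Fin g → Cochain S.K 1) : Prop where
  linearIndependent : LinearIndependent ℂ σ
  span_eq : Submodule.span ℂ (Set.range σ) = holomorphicCochains S ip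
  aPeriods : ∀ i j, (σ i).eval (a j) = if i = j then 1 else 0

/-- The matrix of `B`-periods `πᵢⱼ = σᵢ(bⱼ)`. -/
def periodMatrix {K : AbstractSimplicialComplex V} {g : ℕ} (b : Fin g → Chain K 1)
    (σ : Fin g → Cochain K 1) : Matrix (Fin g) (Fin g) ℂ :=
  Matrix.of fun i j => (σ i).eval (b j)

end Star

end Surface

end

open scoped ComplexConjugate
set_option linter.unusedSectionVars false

/-! ### Vertices of simplices -/

section Vertices

variable {V : Type*} [LinearOrder V] {K : AbstractSimplicialComplex V}

/-! The argument is the classical one for Riemann surfaces, with the operator `i★` on harmonic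
cochains in place of the complex structure.

The topological input is Poincaré duality, proved by hand (`exists_isPoincareDual`). Near a vertex
`v` a cycle `c` is, up to sign, the boundary of a weighted sum `d v` of oriented triangles. For an
edge `vw` the chain `d w - d v` has no boundary along that edge, so it has one common coefficient on
the triangles there; that number is the value of the dual cochain on `vw`. Integration by parts in
each triangle then gives `α(c) = (α ∪ η)[M]`. A canonical homology basis thus yields cochains with
prescribed periods, and Riemann's bilinear relation (`IsCanonicalHomologyBasis.cupPairing_eq`)
follows, because a closed cochain without periods is exact and exact cochains pair to zero with
closed ones.

The analytic input is that `i★` on `H¹` is self-adjoint, since the product is skew and real, and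
injective, by duality. Holomorphic cochains are spanned by its eigenvectors with eigenvalue at least
zero, hence `i(σ ∪ σ̄)[M] > 0` for `σ ≠ 0`. Conjugation reverses the sign of the eigenvalue, so `H¹`
is the sum of the holomorphic cochains and their conjugates, and two holomorphic cochains have
product zero.

With the bilinear relation, positivity makes the A-period map injective, and the decomposition of
`H¹` makes it surjective; no dimension count is needed. Vanishing products give symmetry of `Π`, and
positivity on real combinations of the `σᵢ` gives `Im Π > 0`. -/

/-- The `i`-th vertex of a simplex, in increasing order. -/
def Simplex.vertex {j : ℕ} (s : Simplex K j) (i : Fin (j + 1)) : V :=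
  s.1.orderEmbOfFin s.2.2 i

theorem Simplex.vertex_injective {j : ℕ} (s : Simplex K j) : Function.Injective s.vertex :=
  (s.1.orderEmbOfFin s.2.2).injective

theorem Simplex.vertex_mem {j : ℕ} (s : Simplex K j) (i : Fin (j + 1)) : s.vertex i ∈ s.1 :=
  s.1.orderEmbOfFin_mem s.2.2 i

theorem Simplex.mem_iff_exists_vertex {j : ℕ} (s : Simplex K j) (v : V) :
    v ∈ s.1 ↔ ∃ i, s.vertex i = v := by
  rw [← Finset.mem_coe, ← Finset.range_orderEmbOfFin s.1 s.2.2]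
  rfl

theorem Simplex.ext_vertex {j : ℕ} {s t : Simplex K j} (h : ∀ i, s.vertex i = t.vertex i) :
    s = t := by
  refine Subtype.ext (Finset.ext fun v => ?_)
  simp only [Simplex.mem_iff_exists_vertex, h]

theorem Simplex.vertex_face {j : ℕ} (s : Simplex K (j + 1)) (i : Fin (j + 2)) (k : Fin (j + 1)) :
    (s.face i).vertex k = s.vertex (i.succAbove k) := by
  have h := Finset.orderEmbOfFin_unique (s := (s.face i).1) (s.face i).2.2
    (f := fun k => s.vertex (i.succAbove k)) (fun k => ?_) ?_
  · exact (congrFun h k).symm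
  · refine Finset.mem_erase.2 ⟨fun h => ?_, s.vertex_mem _⟩
    exact Fin.succAbove_ne i k (s.vertex_injective h)
  · exact (s.1.orderEmbOfFin s.2.2).strictMono.comp (Fin.strictMono_succAbove i)

theorem Simplex.vertex_mem_face_iff {j : ℕ} (s : Simplex K (j + 1)) (i k : Fin (j + 2)) :
    s.vertex k ∈ (s.face i).1 ↔ k ≠ i := by
  refine ⟨fun h hk => ?_, fun h => Finset.mem_erase.2 ⟨fun h' => h (s.vertex_injective h'),
    s.vertex_mem _⟩⟩
  exact (Finset.mem_erase.1 h).1 (by rw [hk]; rfl)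

theorem Simplex.face_injective {j : ℕ} (s : Simplex K (j + 1)) : Function.Injective s.face := by
  intro i k h
  by_contra hne
  exact (s.vertex_mem_face_iff k i).not.1 (h ▸ (s.vertex_mem_face_iff i i).not.2 (by simp)) hne

/-- A simplex of dimension zero. -/
def Simplex.point (K : AbstractSimplicialComplex V) (v : V) : Simplex K 0 :=
  ⟨{v}, K.singleton_mem v, rfl⟩

theorem Simplex.point_injective : Function.Injective (Simplex.point K) := fun _ _ h =>
  Finset.singleton_injective (congrArg Subtype.val h)

theorem Simplex.vertex_point (v : V) (i : Fin 1) : (Simplex.point K v).vertex i = v := by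
  simpa [Simplex.point] using (Simplex.point K v).vertex_mem i

theorem Simplex.eq_point (s : Simplex K 0) : s = Simplex.point K (s.vertex 0) :=
  Simplex.ext_vertex fun i => by
    rw [Simplex.vertex_point, show i = 0 from Subsingleton.elim (α := Fin 1) i 0]

theorem Simplex.face_zero_edge (e : Simplex K 1) : e.face 0 = Simplex.point K (e.vertex 1) := by
  rw [Simplex.eq_point (e.face 0), Simplex.vertex_face]; rfl

theorem Simplex.face_one_edge (e : Simplex K 1) : e.face 1 = Simplex.point K (e.vertex 0) := by
  rw [Simplex.eq_point (e.face 1), Simplex.vertex_face]; rfl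

/-- The edge joining two different vertices. -/
def Simplex.edge (v w : V) (h : v ≠ w ∧ ({v, w} : Finset V) ∈ K.faces) : Simplex K 1 :=
  ⟨{v, w}, h.2, Finset.card_pair h.1⟩

theorem Simplex.eq_edge_of_mem (e : Simplex K 1) {v : V} (h : v ∈ e.1) :
    ∃ (w : V) (h : v ≠ w ∧ ({v, w} : Finset V) ∈ K.faces), e = Simplex.edge v w h := by
  obtain ⟨x, y, hne, hxy⟩ := Finset.card_eq_two.1 e.2.2
  have he := e.2.1
  rw [hxy, Finset.mem_insert, Finset.mem_singleton] at h
  obtain rfl | rfl := h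
  · exact ⟨y, ⟨hne, hxy ▸ he⟩, Subtype.ext hxy⟩
  · exact ⟨x, ⟨hne.symm, by rw [Finset.pair_comm, ← hxy]; exact he⟩,
      Subtype.ext (hxy.trans (Finset.pair_comm _ _))⟩

theorem Simplex.edge_eq_face {v w : V} (h : v ≠ w ∧ ({v, w} : Finset V) ∈ K.faces)
    (t : Simplex K 2) (hv : v ∈ t.1) (hw : w ∈ t.1) {i : Fin 3} (hvi : t.vertex i ≠ v)
    (hwi : t.vertex i ≠ w) : Simplex.edge v w h = t.face i := by
  refine Subtype.ext (Finset.eq_of_subset_of_card_le ?_ ?_)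
  · intro x hx
    simp only [Simplex.edge, Finset.mem_insert, Finset.mem_singleton] at hx
    obtain rfl | rfl := hx
    · exact Finset.mem_erase.2 ⟨hvi.symm, hv⟩
    · exact Finset.mem_erase.2 ⟨hwi.symm, hw⟩
  · rw [(t.face i).2.2, (Simplex.edge v w h).2.2]

/-- An edge contained in a triangle is one of its faces. -/
theorem Simplex.exists_face_eq (t : Simplex K 2) (e : Simplex K 1) (h : e.1 ⊆ t.1) :
    ∃ i, t.face i = e := by
  have hc : (t.1 \ e.1).card = 1 := by
    rw [Finset.card_sdiff_of_subset h, t.2.2, e.2.2]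
  obtain ⟨x, hx⟩ := Finset.card_eq_one.1 hc
  have hxt : x ∈ t.1 \ e.1 := hx ▸ Finset.mem_singleton_self x
  obtain ⟨i, rfl⟩ := (t.mem_iff_exists_vertex x).1 (Finset.mem_sdiff.1 hxt).1
  refine ⟨i, Subtype.ext (Finset.eq_of_subset_of_card_le (fun y hy => ?_) ?_).symm⟩
  · refine Finset.mem_erase.2 ⟨fun hyi => (Finset.mem_sdiff.1 hxt).2 ?_, h hy⟩
    rw [← show y = t.vertex i from hyi]; exact hy
  · rw [(t.face i).2.2, e.2.2]

theorem Simplex.face_subset {j : ℕ} (s : Simplex K (j + 1)) (i : Fin (j + 2)) :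
    (s.face i).1 ⊆ s.1 := Finset.erase_subset _ _

end Vertices

/-! ### Boundary and coboundary -/

section Stokes

variable {V : Type*} [Fintype V] [LinearOrder V] {K : AbstractSimplicialComplex V}

/-- Combinatorial Stokes: both sides are the same double sum over simplices and their faces. -/
theorem Cochain.eval_coboundary {j : ℕ} (f : Cochain K j) (c : Chain K (j + 1)) :
    (coboundary K j f).eval c = f.eval (boundary K j c) := by
  simp only [Cochain.eval, coboundary, boundary, LinearMap.coe_mk, AddHom.coe_mk, Int.cast_sum,
    Finset.sum_mul, Finset.mul_sum]
  conv_rhs => rw [Finset.sum_comm]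
  refine Finset.sum_congr rfl fun t _ => ?_
  conv_rhs => rw [Finset.sum_comm]
  refine Finset.sum_congr rfl fun i _ => ?_
  rw [Finset.sum_eq_single (t.face i)]
  · simp; ring
  · intro s _ hs
    simp [Ne.symm hs]
  · simp

theorem Cochain.eval_add_right {j : ℕ} (f : Cochain K j) (c d : Chain K j) :
    f.eval (c + d) = f.eval c + f.eval d := by
  simp [Cochain.eval, add_mul, Finset.sum_add_distrib]

theorem Cochain.eval_sub_right {j : ℕ} (f : Cochain K j) (c d : Chain K j) :
    f.eval (c - d) = f.eval c - f.eval d := by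
  simp [Cochain.eval, sub_mul, Finset.sum_sub_distrib]

theorem Cochain.eval_zsmul_right {j : ℕ} (f : Cochain K j) (n : ℤ) (c : Chain K j) :
    f.eval (n • c) = n * f.eval c := by
  simp [Cochain.eval, Finset.mul_sum, mul_assoc]

theorem Cochain.eval_sum_right {j : ℕ} {ι : Type*} (f : Cochain K j) (s : Finset ι)
    (c : ι → Chain K j) : f.eval (∑ k ∈ s, c k) = ∑ k ∈ s, f.eval (c k) := by
  classical
  induction s using Finset.induction_on with
  | empty => simp [Cochain.eval]
  | insert x s hx ih => rw [Finset.sum_insert hx, Finset.sum_insert hx, Cochain.eval_add_right, ih]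

theorem Cochain.eval_sum {j : ℕ} {ι : Type*} (s : Finset ι) (f : ι → Cochain K j)
    (c : Chain K j) : (∑ k ∈ s, f k).eval c = ∑ k ∈ s, (f k).eval c := by
  classical
  induction s using Finset.induction_on with
  | empty => simp [Cochain.eval]
  | insert x s hx ih => rw [Finset.sum_insert hx, Finset.sum_insert hx, Cochain.eval_add, ih]

theorem Cochain.eval_sub {j : ℕ} (f g : Cochain K j) (c : Chain K j) :
    (f - g).eval c = f.eval c - g.eval c := by
  simp [Cochain.eval, mul_sub, Finset.sum_sub_distrib]

theorem Cochain.eval_star {j : ℕ} (f : Cochain K j) (c : Chain K j) :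
    Cochain.eval (star f) c = conj (f.eval c) := by
  simp [Cochain.eval]

theorem Cochain.eval_single {j : ℕ} (f : Cochain K j) (s : Simplex K j) :
    f.eval (Pi.single s 1) = f s := by
  rw [Cochain.eval, Finset.sum_eq_single s] <;> simp +contextual

theorem Chain.eq_of_forall_eval {j : ℕ} {c d : Chain K j}
    (h : ∀ f : Cochain K j, f.eval c = f.eval d) : c = d := by
  funext s
  have := h (Pi.single s 1)
  simpa [Cochain.eval, Pi.single_apply] using this

theorem coboundary_edge_apply (f : Cochain K 0) (e : Simplex K 1) :
    coboundary K 0 f e = f (e.face 0) - f (e.face 1) := by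
  simp [coboundary, sub_eq_add_neg]

theorem coboundary_triangle_apply (f : Cochain K 1) (t : Simplex K 2) :
    coboundary K 1 f t = f (t.face 0) - f (t.face 1) + f (t.face 2) := by
  simp [coboundary, Fin.sum_univ_three, sub_eq_add_neg]

theorem boundary_single_edge (e : Simplex K 1) :
    boundary K 0 (Pi.single e 1) = Pi.single (e.face 0) 1 - Pi.single (e.face 1) 1 := by
  refine Chain.eq_of_forall_eval fun f => ?_
  rw [← Cochain.eval_coboundary, Cochain.eval_single, Cochain.eval_sub_right, Cochain.eval_single,
    Cochain.eval_single, coboundary_edge_apply]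

/-- `δ ∘ δ = 0` in degree zero. -/
theorem coboundary_coboundary (f : Cochain K 0) : coboundary K 1 (coboundary K 0 f) = 0 := by
  funext t
  simp only [coboundary_triangle_apply, coboundary_edge_apply, Simplex.face_zero_edge,
    Simplex.face_one_edge, Simplex.vertex_face, Pi.zero_apply]
  simp [Fin.succAbove]

/-! ### Integration along edge paths -/

theorem exists_chain_of_reachable {u v : V} (h : (oneSkeleton K).Reachable u v) :
    ∃ c : Chain K 1, boundary K 0 c =
      Pi.single (Simplex.point K v) 1 - Pi.single (Simplex.point K u) 1 := by
  obtain ⟨p⟩ := h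
  induction p with
  | nil => exact ⟨0, by simp⟩
  | @cons u v w huv p ih =>
    obtain ⟨c, hc⟩ := ih
    have hb := boundary_single_edge (Simplex.edge u v huv)
    have hu := ((Simplex.edge u v huv).mem_iff_exists_vertex u).1 (by simp [Simplex.edge])
    have hv := ((Simplex.edge u v huv).mem_iff_exists_vertex v).1 (by simp [Simplex.edge])
    obtain ⟨i, hi⟩ := hu
    obtain ⟨k, hk⟩ := hv
    rw [Simplex.face_zero_edge, Simplex.face_one_edge] at hb
    have hne := huv.1
    fin_cases i <;> fin_cases k <;> simp only [Fin.mk_one, Fin.zero_eta] at hi hk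
    · exact absurd (hi.symm.trans hk) hne
    · refine ⟨c + Pi.single (Simplex.edge u v huv) 1, ?_⟩
      rw [map_add, hc, hb, hi, hk]; abel
    · refine ⟨c - Pi.single (Simplex.edge u v huv) 1, ?_⟩
      rw [map_sub, hc, hb, hi, hk]; abel
    · exact absurd (hi.symm.trans hk) hne

/-- A `1`-cochain all of whose periods vanish is exact. -/
theorem exists_eq_coboundary_of_periods_eq_zero (hconn : (oneSkeleton K).Connected)
    (α : Cochain K 1) (h : ∀ z : Chain K 1, boundary K 0 z = 0 → α.eval z = 0) :
    ∃ f : Cochain K 0, α = coboundary K 0 f := by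
  obtain ⟨v₀⟩ := hconn.nonempty
  choose c hc using fun v => exists_chain_of_reachable (hconn.preconnected v₀ v)
  -- The primitive is the integral of `α` along a chosen path from `v₀`. Two such paths and the edge
  -- joining their ends close up to a cycle, where `α` vanishes.
  refine ⟨fun s => α.eval (c (s.vertex 0)), funext fun e => ?_⟩
  have hz := h (c (e.vertex 1) - c (e.vertex 0) - Pi.single e 1) (by
    rw [map_sub, map_sub, hc, hc, boundary_single_edge, Simplex.face_zero_edge,
      Simplex.face_one_edge]; abel)
  rw [Cochain.eval_sub_right, Cochain.eval_sub_right, Cochain.eval_single] at hz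
  rw [coboundary_edge_apply, Simplex.face_zero_edge, Simplex.face_one_edge, Simplex.vertex_point,
    Simplex.vertex_point]
  linear_combination -hz

end Stokes

/-! ### Poincaré duality -/

section Duality

variable {V : Type*} [Fintype V] [LinearOrder V]

/-- Integration by parts on one triangle: if `η = df` there and `α` is closed, then `∫ α ∧ df = -∫ f
α` over the boundary. On an edge `f` is affine and `W α` is constant, so that integral is `α` times
the mean of the end values of `f`; this is the factor `1/2`. The primitive `d · t` may depend on
`t`. -/
theorem cup_apply_of_primitive {K : AbstractSimplicialComplex V} {α η : Cochain K 1}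
    (hα : coboundary K 1 α = 0) (d : V → Simplex K 2 → ℂ) (t : Simplex K 2)
    (hη : ∀ i, η (t.face i) = d ((t.face i).vertex 1) t - d ((t.face i).vertex 0) t) :
    cup α η t = -(1 / 2 : ℂ) * ∑ i : Fin 3, (-1) ^ (i : ℕ) *
      (α (t.face i) * (d ((t.face i).vertex 0) t + d ((t.face i).vertex 1) t)) := by
  have h := congrFun hα t
  rw [coboundary_triangle_apply, Pi.zero_apply] at h
  have h1 : α (t.face 1) = α (t.face 0) + α (t.face 2) := by
    linear_combination -h
  rw [cup_apply]
  simp only [hη, Simplex.vertex_face, Fin.sum_univ_three, h1]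
  simp [Fin.succAbove]
  ring

/-- The boundary with complex coefficients of the `2`-chain with coefficient `x t` times that of
the fundamental cycle. -/
noncomputable def fundamentalBoundary (S : TriangulatedSurface V) :
    (Simplex S.K 2 → ℂ) →ₗ[ℂ] (Simplex S.K 1 → ℂ) where
  toFun x e := ∑ t : Simplex S.K 2, ∑ i : Fin 3,
    if t.face i = e then (-1 : ℂ) ^ (i : ℕ) * (S.fundamentalCycle t * x t) else 0
  map_add' x y := by
    funext e
    simp only [Pi.add_apply, ← Finset.sum_add_distrib]
    refine Finset.sum_congr rfl fun t _ => Finset.sum_congr rfl fun i _ => ?_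
    split_ifs <;> ring
  map_smul' r x := by
    funext e
    simp only [Pi.smul_apply, smul_eq_mul, RingHom.id_apply, Finset.mul_sum]
    refine Finset.sum_congr rfl fun t _ => Finset.sum_congr rfl fun i _ => ?_
    split_ifs <;> ring

variable (S : TriangulatedSurface V)

theorem fundamentalBoundary_apply (x : Simplex S.K 2 → ℂ) (e : Simplex S.K 1) :
    fundamentalBoundary S x e = ∑ t : Simplex S.K 2, ∑ i : Fin 3,
      if t.face i = e then (-1 : ℂ) ^ (i : ℕ) * (S.fundamentalCycle t * x t) else 0 := rfl

theorem sum_mul_fundamentalBoundary (φ : Simplex S.K 1 → ℂ) (x : Simplex S.K 2 → ℂ) :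
    ∑ e, φ e * fundamentalBoundary S x e =
      ∑ t, S.fundamentalCycle t * x t * ∑ i : Fin 3, (-1) ^ (i : ℕ) * φ (t.face i) := by
  simp only [fundamentalBoundary_apply, Finset.mul_sum]
  rw [Finset.sum_comm]
  refine Finset.sum_congr rfl fun t _ => ?_
  rw [Finset.sum_comm]
  refine Finset.sum_congr rfl fun i _ => ?_
  rw [Finset.sum_eq_single (t.face i)]
  · simp; ring
  · intro e _ he
    simp [he.symm]
  · simp

/-- A constant weight gives `r ∂[M]`, and `[M]` is a cycle. -/
theorem fundamentalBoundary_const (r : ℂ) : fundamentalBoundary S (fun _ => r) = 0 := by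
  funext e
  have h := congrArg (fun n : ℤ => r * (n : ℂ)) (congrFun S.boundary_fundamentalCycle e)
  simp only [boundary, LinearMap.coe_mk, AddHom.coe_mk, Pi.zero_apply, Int.cast_zero, mul_zero,
    Int.cast_sum, Finset.mul_sum] at h
  rw [fundamentalBoundary_apply, Pi.zero_apply]
  refine Eq.trans ?_ h
  refine Finset.sum_congr rfl fun t _ => Finset.sum_congr rfl fun i _ => ?_
  split_ifs
  · push_cast; ring
  · simp

/-- The triangle formula summed over `[M]` and regrouped by edges. -/
theorem cup_eval_of_primitive {α η : Cochain S.K 1} (hα : coboundary S.K 1 α = 0)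
    (d : V → Simplex S.K 2 → ℂ)
    (hη : ∀ t i, η (t.face i) = d ((t.face i).vertex 1) t - d ((t.face i).vertex 0) t) :
    (cup α η).eval S.fundamentalCycle = -(1 / 2 : ℂ) * ∑ e, α e *
      (fundamentalBoundary S (d (e.vertex 0)) e + fundamentalBoundary S (d (e.vertex 1)) e) := by
  have key : ∀ e, α e * (fundamentalBoundary S (d (e.vertex 0)) e +
      fundamentalBoundary S (d (e.vertex 1)) e) = ∑ t : Simplex S.K 2, ∑ i : Fin 3,
        if t.face i = e then S.fundamentalCycle t * ((-1 : ℂ) ^ (i : ℕ) *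
          (α (t.face i) * (d ((t.face i).vertex 0) t + d ((t.face i).vertex 1) t))) else 0 := by
    intro e
    simp only [fundamentalBoundary_apply, ← Finset.sum_add_distrib, Finset.mul_sum]
    refine Finset.sum_congr rfl fun t _ => Finset.sum_congr rfl fun i _ => ?_
    split_ifs with h
    · rw [h]; ring
    · simp
  simp only [key]
  rw [Finset.sum_comm, Cochain.eval, Finset.mul_sum]
  refine Finset.sum_congr rfl fun t _ => ?_
  rw [cup_apply_of_primitive hα d t (hη t), Finset.sum_comm, Finset.mul_sum, Finset.mul_sum,
    Finset.mul_sum]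
  refine Finset.sum_congr rfl fun i _ => ?_
  rw [Finset.sum_ite_eq]
  simp; ring

/-- The product of a closed and an exact cochain vanishes on the fundamental cycle. -/
theorem cup_coboundary_eval {α : Cochain S.K 1} (hα : coboundary S.K 1 α = 0)
    (f : Cochain S.K 0) : (cup α (coboundary S.K 0 f)).eval S.fundamentalCycle = 0 := by
  -- An exact cochain has a global primitive, so every weight is constant over the triangles and has
  -- zero boundary.
  rw [cup_eval_of_primitive S hα (fun v _ => f (Simplex.point S.K v))]
  · simp [fundamentalBoundary_const]
  · intro t i
    rw [coboundary_edge_apply, Simplex.face_zero_edge, Simplex.face_one_edge]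

theorem cup_eval_swap (α β : Cochain S.K 1) :
    (cup α β).eval S.fundamentalCycle = -(cup β α).eval S.fundamentalCycle := by
  simp only [Cochain.eval, ← Finset.sum_neg_distrib]
  refine Finset.sum_congr rfl fun t _ => ?_
  rw [cup_apply, cup_apply]
  ring

/-! #### Local structure of a surface -/

/-- An edge is contained in at most two triangles. -/
theorem exists_two_triangles (e : Simplex S.K 1) :
    ∃ t₁ t₂ : Simplex S.K 2, ∀ t, e.1 ⊆ t.1 → t = t₁ ∨ t = t₂ := by
  obtain ⟨v, hv⟩ : ∃ v, v ∈ e.1 := ⟨_, e.vertex_mem 0⟩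
  obtain ⟨w, h, rfl⟩ := e.eq_edge_of_mem hv
  -- Triangles on the edge `vw` correspond to the neighbours of `w` in the link of `v`, of which
  -- there are two.
  obtain ⟨x, y, -, hxy⟩ := Set.ncard_eq_two.1 (S.link_degree v ⟨w, h⟩)
  have hx : x ∈ (linkGraph S.K v).neighborSet ⟨w, h⟩ := by rw [hxy]; simp
  have hy : y ∈ (linkGraph S.K v).neighborSet ⟨w, h⟩ := by rw [hxy]; simp
  have hcard : ∀ z ∈ (linkGraph S.K v).neighborSet ⟨w, h⟩,
      ({v, w, z.1} : Finset V).card = 2 + 1 := fun z hz =>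
    Finset.card_eq_three.2 ⟨v, w, z.1, h.1, z.2.1, fun h' => hz.1 (Subtype.ext h'), rfl⟩
  refine ⟨⟨_, hx.2, hcard x hx⟩, ⟨_, hy.2, hcard y hy⟩, fun t ht => ?_⟩
  have hvt : v ∈ t.1 := ht (by simp [Simplex.edge])
  have hwt : w ∈ t.1 := ht (by simp [Simplex.edge])
  have hc : (t.1 \ {v, w}).card = 1 := by
    rw [show ({v, w} : Finset V) = (Simplex.edge v w h).1 from rfl,
      Finset.card_sdiff_of_subset ht, t.2.2, (Simplex.edge v w h).2.2]
  obtain ⟨z, hz⟩ := Finset.card_eq_one.1 hc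
  have ht' : t.1 = {v, w, z} := by
    have := Finset.union_sdiff_of_subset ht
    rw [show (Simplex.edge v w h).1 = {v, w} from rfl, hz] at this
    rw [← this]
    ext; simp
  have hzt : z ∈ t.1 \ {v, w} := hz ▸ Finset.mem_singleton_self z
  simp only [Finset.mem_sdiff, Finset.mem_insert, Finset.mem_singleton, not_or] at hzt
  have hvz : v ≠ z ∧ ({v, z} : Finset V) ∈ S.K.faces :=
    ⟨Ne.symm hzt.2.1, (S.K.isRelLowerSet_faces t.2.1).2
      (Finset.insert_subset hvt (Finset.singleton_subset_iff.2 hzt.1)) (by simp)⟩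
  have hmem : (⟨z, hvz⟩ : {w : V // v ≠ w ∧ ({v, w} : Finset V) ∈ S.K.faces}) ∈
      (linkGraph S.K v).neighborSet ⟨w, h⟩ :=
    ⟨fun h' => hzt.2.2 (congrArg Subtype.val h').symm, ht' ▸ t.2.1⟩
  rw [hxy] at hmem
  obtain h' | h' := hmem
  · exact Or.inl (Subtype.ext (ht'.trans (by simp [← h'])))
  · exact Or.inr (Subtype.ext (ht'.trans (by simp [← Set.mem_singleton_iff.1 h'])))

/-- Subtracting the constant `x t'` leaves the boundary unchanged and kills the weight of `t'`. At
most one other triangle, `t`, meets `e`, so the boundary there is `±(x t - x t')`. -/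
theorem eq_of_fundamentalBoundary_eq_zero {x : Simplex S.K 2 → ℂ} {e : Simplex S.K 1}
    (hx : fundamentalBoundary S x e = 0) {t t' : Simplex S.K 2} (ht : e.1 ⊆ t.1)
    (ht' : e.1 ⊆ t'.1) : x t = x t' := by
  by_cases hne : t = t'
  · rw [hne]
  have hpair : ∀ s : Simplex S.K 2, e.1 ⊆ s.1 → s = t ∨ s = t' := by
    obtain ⟨t₁, t₂, h⟩ := exists_two_triangles S e
    intro s hs
    have := h s hs
    have := h t ht
    have := h t' ht'
    grind
  obtain ⟨i, hi⟩ := t.exists_face_eq e ht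
  have hsub : fundamentalBoundary S (fun s => x s - x t') e = 0 := by
    have h := map_sub (fundamentalBoundary S) x (fun _ => x t')
    rw [fundamentalBoundary_const, sub_zero] at h
    rw [← hx, ← h]; rfl
  rw [fundamentalBoundary_apply, Finset.sum_eq_single t, Finset.sum_eq_single i, if_pos hi] at hsub
  · have hS : (S.fundamentalCycle t : ℂ) ≠ 0 := by
      obtain h | h := S.fundamentalCycle_coeff t <;> simp [h]
    have h1 : (-1 : ℂ) ^ (i : ℕ) ≠ 0 := pow_ne_zero _ (by simp)
    simpa [h1, hS, sub_eq_zero] using hsub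
  · intro k _ hk
    rw [if_neg fun h => hk (t.face_injective (h.trans hi.symm))]
  · simp
  · intro s _ hs
    refine Finset.sum_eq_zero fun k _ => ?_
    split_ifs with h
    · obtain rfl | rfl := hpair s (h ▸ s.face_subset k)
      · exact absurd rfl hs
      · simp
    · rfl
  · simp

/-- The sign with which the vertex `v` appears in the boundary of the edge `e`. -/
noncomputable def edgeSign {K : AbstractSimplicialComplex V} (v : V) (e : Simplex K 1) : ℂ :=
  -- Edges missing `v` also get `1`; the sign only matters on edges through `v`.
  if e.vertex 0 = v then -1 else 1

theorem edgeSign_mul_self {K : AbstractSimplicialComplex V} (v : V) (e : Simplex K 1) :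
    edgeSign v e * edgeSign v e = 1 := by
  unfold edgeSign; split_ifs <;> simp

/-! ### Functionals on the edges at a vertex -/

/-- The boundary of a triangle enters each vertex along one edge and leaves along the other, so a
functional on the edges at the vertex that kills this boundary takes equal values on the two edges
once both are oriented towards the vertex. -/
theorem edgeSign_face_mul_eq {K : AbstractSimplicialComplex V} (t : Simplex K 2)
    (φ : Simplex K 1 → ℂ) {m k l : Fin 3} (hmk : m ≠ k) (hml : m ≠ l) (hkl : k ≠ l)
    (h : ∑ i : Fin 3, (-1 : ℂ) ^ (i : ℕ) *
      (if t.vertex m ∈ (t.face i).1 then φ (t.face i) else 0) = 0) :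
    edgeSign (t.vertex m) (t.face l) * φ (t.face l) =
      edgeSign (t.vertex m) (t.face k) * φ (t.face k) := by
  simp only [Simplex.vertex_mem_face_iff, Fin.sum_univ_three] at h
  simp only [edgeSign, Simplex.vertex_face, t.vertex_injective.eq_iff]
  fin_cases m <;> fin_cases k <;> fin_cases l <;> simp [Fin.succAbove] at hmk hml hkl h ⊢ <;>
    first
    | linear_combination h
    | linear_combination -h

theorem edgeSign_mul_eq_of_adj {v : V} (φ : Simplex S.K 1 → ℂ)
    (h : ∀ t : Simplex S.K 2, v ∈ t.1 → ∑ i : Fin 3, (-1 : ℂ) ^ (i : ℕ) *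
      (if v ∈ (t.face i).1 then φ (t.face i) else 0) = 0)
    (w w' : {w : V // v ≠ w ∧ ({v, w} : Finset V) ∈ S.K.faces})
    (hadj : (linkGraph S.K v).Adj w w') :
    edgeSign v (Simplex.edge v w.1 w.2) * φ (Simplex.edge v w.1 w.2) =
      edgeSign v (Simplex.edge v w'.1 w'.2) * φ (Simplex.edge v w'.1 w'.2) := by
  have hww : w.1 ≠ w'.1 := fun h' => hadj.1 (Subtype.ext h')
  obtain ⟨t, ht⟩ : ∃ t : Simplex S.K 2, t.1 = {v, w.1, w'.1} := ⟨⟨_, hadj.2,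
    Finset.card_eq_three.2 ⟨v, w.1, w'.1, w.2.1, w'.2.1, hww, rfl⟩⟩, rfl⟩
  have hv : v ∈ t.1 := by simp [ht]
  have hw : w.1 ∈ t.1 := by simp [ht]
  have hw' : w'.1 ∈ t.1 := by simp [ht]
  obtain ⟨m, hm⟩ := (t.mem_iff_exists_vertex _).1 hv
  obtain ⟨k, hk⟩ := (t.mem_iff_exists_vertex _).1 hw
  obtain ⟨l, hl⟩ := (t.mem_iff_exists_vertex _).1 hw'
  rw [Simplex.edge_eq_face w.2 t hv hw (i := l) (hl ▸ w'.2.1.symm) (hl ▸ hww.symm),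
    Simplex.edge_eq_face w'.2 t hv hw' (i := k) (hk ▸ w.2.1.symm) (hk ▸ hww)]
  have := h t hv
  simp only [← hm] at this ⊢
  refine edgeSign_face_mul_eq t φ ?_ ?_ ?_ this
  · rintro rfl; exact w.2.1 (hm.symm.trans hk)
  · rintro rfl; exact w'.2.1 (hm.symm.trans hl)
  · rintro rfl; exact hww (hk.symm.trans hl)

/-- The signed values agree on adjacent vertices of the link of `v`, and the link is connected. -/
theorem exists_edgeSign_mul_eq {v : V} (φ : Simplex S.K 1 → ℂ)
    (h : ∀ t : Simplex S.K 2, v ∈ t.1 → ∑ i : Fin 3, (-1 : ℂ) ^ (i : ℕ) *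
      (if v ∈ (t.face i).1 then φ (t.face i) else 0) = 0) :
    ∃ r : ℂ, ∀ e : Simplex S.K 1, v ∈ e.1 → φ e = r * edgeSign v e := by
  obtain ⟨w₀⟩ := (S.link_connected v).nonempty
  refine ⟨edgeSign v (Simplex.edge v w₀.1 w₀.2) * φ (Simplex.edge v w₀.1 w₀.2), fun e he => ?_⟩
  obtain ⟨w, hw, rfl⟩ := e.eq_edge_of_mem he
  have hconst : ∀ w w' : {w : V // v ≠ w ∧ ({v, w} : Finset V) ∈ S.K.faces},
      edgeSign v (Simplex.edge v w.1 w.2) * φ (Simplex.edge v w.1 w.2) =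
        edgeSign v (Simplex.edge v w'.1 w'.2) * φ (Simplex.edge v w'.1 w'.2) := by
    intro w w'
    obtain ⟨p⟩ := (S.link_connected v).preconnected w w'
    induction p with
    | nil => rfl
    | cons hadj _ ih => exact (edgeSign_mul_eq_of_adj S φ h _ _ hadj).trans ih
  rw [hconst w₀ ⟨w, hw⟩]
  linear_combination (-φ (Simplex.edge v w hw)) * edgeSign_mul_self v (Simplex.edge v w hw)

/-- The sum is the coefficient of `∂c` at `v`, read off by pairing with the indicator of `v`. -/
theorem sum_edgeSign_mul_eq_zero (v : V) (c : Chain S.K 1) (hc : boundary S.K 0 c = 0) :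
    ∑ e : Simplex S.K 1, (if v ∈ e.1 then edgeSign v e * c e else 0) = 0 := by
  have h := Cochain.eval_coboundary (Pi.single (Simplex.point S.K v) 1 : Cochain S.K 0) c
  rw [hc] at h
  have h0 : Cochain.eval (Pi.single (Simplex.point S.K v) 1 : Cochain S.K 0)
      (0 : Chain S.K 0) = 0 := by simp [Cochain.eval]
  refine Eq.trans ?_ (h.trans h0)
  refine Finset.sum_congr rfl fun e _ => ?_
  rw [coboundary_edge_apply, Simplex.face_zero_edge, Simplex.face_one_edge]
  simp only [Pi.single_apply, Simplex.point_injective.eq_iff, edgeSign]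
  have hmem := e.mem_iff_exists_vertex v
  have hne : e.vertex 0 ≠ e.vertex 1 := e.vertex_injective.ne (by simp)
  rw [Fin.exists_fin_two] at hmem
  by_cases h0 : e.vertex 0 = v
  · have h1 : e.vertex 1 ≠ v := fun h1 => hne (h0.trans h1.symm)
    simp [hmem, h0, h1]
  · by_cases h1 : e.vertex 1 = v <;> simp [hmem, h0, h1]

/-- Near a vertex, every cycle is the boundary of a chain of triangles. -/
theorem exists_fundamentalBoundary_eq (v : V) (c : Chain S.K 1) (hc : boundary S.K 0 c = 0) :
    ∃ x : Simplex S.K 2 → ℂ, ∀ e : Simplex S.K 1, v ∈ e.1 →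
      fundamentalBoundary S x e = -c e := by
  let P : (Simplex S.K 1 → ℂ) →ₗ[ℂ] (Simplex S.K 1 → ℂ) :=
    { toFun := fun y e => if v ∈ e.1 then y e else 0
      map_add' := fun y z => by funext e; by_cases h : v ∈ e.1 <;> simp [h]
      map_smul' := fun r y => by funext e; by_cases h : v ∈ e.1 <;> simp [h] }
  have hP : ∀ y e, P y e = if v ∈ e.1 then y e else 0 := fun _ _ => rfl
  let y : Simplex S.K 1 → ℂ := fun e => -c e
  -- Linear duality: a functional killing the boundaries of all triangles, truncated to the edges at
  -- `v`, is a multiple of `edgeSign v` there. Its value on `c` is then a multiple of the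
  -- coefficient of `∂c` at `v`, which is zero.
  have hy : P y ∈ LinearMap.range (P ∘ₗ fundamentalBoundary S) := by
    by_contra hy
    obtain ⟨f, hf, hle⟩ := Submodule.exists_le_ker_of_notMem hy
    let φ : Simplex S.K 1 → ℂ := fun e => f (Pi.single e 1)
    have hfφ : ∀ z, f (P z) = ∑ e, (if v ∈ e.1 then φ e else 0) * z e := by
      intro z
      rw [LinearMap.pi_apply_eq_sum_univ f]
      refine Finset.sum_congr rfl fun e _ => ?_
      rw [hP]
      have : f (fun j => if e = j then 1 else 0) = φ e := by
        congr 1; funext j; simp [Pi.single_apply, eq_comm]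
      rw [this]
      split_ifs <;> simp [mul_comm]
    obtain ⟨r, hr⟩ := exists_edgeSign_mul_eq S (v := v) φ (by
      intro t _
      have h0 : f (P (fundamentalBoundary S (Pi.single t 1))) = 0 := hle ⟨_, rfl⟩
      rw [hfφ, sum_mul_fundamentalBoundary, Finset.sum_eq_single t] at h0
      · have hS : (S.fundamentalCycle t : ℂ) ≠ 0 := by
          obtain h | h := S.fundamentalCycle_coeff t <;> simp [h]
        simpa [hS] using h0
      · intro s _ hs; simp [hs]
      · simp)
    apply hf
    rw [hfφ]
    calc _ = -r * ∑ e : Simplex S.K 1, (if v ∈ e.1 then edgeSign v e * c e else 0) := by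
          rw [Finset.mul_sum]
          refine Finset.sum_congr rfl fun e _ => ?_
          by_cases h : v ∈ e.1
          · simp [h, hr e h, y]; ring
          · simp [h]
      _ = 0 := by rw [sum_edgeSign_mul_eq_zero S v c hc, mul_zero]
  obtain ⟨x, hx⟩ := hy
  refine ⟨x, fun e he => ?_⟩
  have := congrFun hx e
  simpa [hP, he, y] using this

/-- Every cycle has a Poincaré dual. -/
theorem exists_isPoincareDual (c : Chain S.K 1) (hc : boundary S.K 0 c = 0) :
    ∃ η : Cochain S.K 1, IsPoincareDual S η c := by
  classical
  choose d hd using fun v => exists_fundamentalBoundary_eq S v c hc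
  -- At `e` both local chains have boundary `-c e`, so their difference has none.
  have hwell : ∀ (e : Simplex S.K 1) (t t' : Simplex S.K 2), e.1 ⊆ t.1 → e.1 ⊆ t'.1 →
      d (e.vertex 1) t - d (e.vertex 0) t = d (e.vertex 1) t' - d (e.vertex 0) t' := by
    intro e t t' ht ht'
    refine eq_of_fundamentalBoundary_eq_zero S (x := d (e.vertex 1) - d (e.vertex 0)) ?_ ht ht'
    rw [map_sub, Pi.sub_apply, hd _ e (e.vertex_mem 1), hd _ e (e.vertex_mem 0), sub_self]
  -- The default `0` is harmless: the coboundary and the product see only faces of triangles.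
  let η : Cochain S.K 1 := fun e =>
    if h : ∃ t : Simplex S.K 2, e.1 ⊆ t.1 then
      d (e.vertex 1) h.choose - d (e.vertex 0) h.choose else 0
  have hη : ∀ t i, η (t.face i) = d ((t.face i).vertex 1) t - d ((t.face i).vertex 0) t := by
    intro t i
    have h : ∃ s : Simplex S.K 2, (t.face i).1 ⊆ s.1 := ⟨t, t.face_subset i⟩
    simp only [η, dif_pos h]
    exact hwell _ _ _ h.choose_spec (t.face_subset i)
  refine ⟨η, funext fun t => ?_, fun α hα => ?_⟩
  · simp only [coboundary_triangle_apply, hη, Simplex.vertex_face]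
    simp [Fin.succAbove]
  · rw [cup_eval_of_primitive S hα d hη, Cochain.eval, Finset.mul_sum]
    refine Finset.sum_congr rfl fun e _ => ?_
    -- Each end of `e` contributes `-c e`, which cancels the factor `-1/2`.
    rw [hd _ e (e.vertex_mem 1), hd _ e (e.vertex_mem 0)]
    ring

end Duality

/-! ### Self-adjoint operators for a hermitian form -/

section Spectral

variable {E : Type*} [AddCommGroup E] [Module ℂ E] [FiniteDimensional ℂ E]
  (B : E →ₗ[ℂ] AntiDual E)

theorem exists_orthonormal_eigenbasis (hsymm : ∀ a b, conj (B b a) = B a b)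
    (hpos : ∀ a, a ≠ 0 → 0 < (B a a).re) (T : E →ₗ[ℂ] E)
    (hT : ∀ a b, B (T a) b = B a (T b)) :
    ∃ (n : ℕ) (u : Module.Basis (Fin n) ℂ E) (l : Fin n → ℝ), (∀ i, T (u i) = (l i : ℂ) • u i) ∧
      ∀ i j, B (u i) (u j) = if i = j then 1 else 0 := by
  let core : InnerProductSpace.Core ℂ E :=
    -- The arguments are swapped because Mathlib's inner products are antilinear in the first one.
    { inner := fun x y => B y x
      conj_inner_symm := fun x y => hsymm y x
      re_inner_nonneg := fun x => by
        by_cases hx : x = 0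
        · simp [hx]
        · exact (hpos x hx).le
      add_left := fun x y z => by simp
      smul_left := fun x y r => by simp
      definite := fun x hx => by
        by_contra hne
        have h := hpos x hne
        have hx' : B x x = 0 := hx
        simp [hx'] at h }
  let _ : NormedAddCommGroup E := core.toNormedAddCommGroup
  let _ : InnerProductSpace ℂ E := InnerProductSpace.ofCore core.toCore
  have hTs : T.IsSymmetric := fun x y => (hT y x).symm
  refine ⟨_, (hTs.eigenvectorBasis rfl).toBasis, hTs.eigenvalues rfl, fun i => ?_, fun i j => ?_⟩
  · simp
  · have h : B (hTs.eigenvectorBasis rfl i) (hTs.eigenvectorBasis rfl j) = if j = i then 1 else 0 :=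
      orthonormal_iff_ite.1 (hTs.eigenvectorBasis rfl).orthonormal j i
    simpa [eq_comm] using h

/-- The span of the eigenvectors of `T` with real eigenvalues `l ≥ 0`. -/
def nonnegEigenspan (T : E →ₗ[ℂ] E) : Submodule ℂ E :=
  Submodule.span ℂ {x | ∃ l : ℝ, 0 ≤ l ∧ T x = (l : ℂ) • x}

/-- In an orthonormal eigenbasis the form is `∑ lᵢ |xᵢ|²`. Components with `lᵢ < 0` vanish on the
span, and injectivity rules out `lᵢ = 0`. -/
theorem re_pos_of_mem_nonnegEigenspan (hsymm : ∀ a b, conj (B b a) = B a b)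
    (hpos : ∀ a, a ≠ 0 → 0 < (B a a).re) (T : E →ₗ[ℂ] E)
    (hT : ∀ a b, B (T a) b = B a (T b)) (hinj : ∀ x, T x = 0 → x = 0) {x : E}
    (hx : x ∈ nonnegEigenspan T) (hx0 : x ≠ 0) : 0 < (B (T x) x).re := by
  obtain ⟨n, u, l, hu, horth⟩ := exists_orthonormal_eigenbasis B hsymm hpos T hT
  have hTx : ∀ y, T y = ∑ i, (l i * u.repr y i) • u i := by
    intro y
    conv_lhs => rw [← u.sum_repr y]
    simp only [map_sum, map_smul, hu, smul_smul, mul_comm]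
  have hrepr : ∀ y i, u.repr (T y) i = l i * u.repr y i := by
    intro y i
    rw [hTx y, u.repr_sum_self]
  have hneg : ∀ i, l i < 0 → u.repr x i = 0 := by
    intro i hi
    refine Submodule.span_induction (p := fun y _ => u.repr y i = 0) ?_ (by simp)
      (fun y z _ _ hy hz => by simp [hy, hz]) (fun r y _ hy => by simp [hy]) hx
    rintro y ⟨m, hm, hy⟩
    have h := hrepr y i
    rw [hy, map_smul, Finsupp.smul_apply, smul_eq_mul] at h
    have h' : ((m - l i : ℝ) : ℂ) * u.repr y i = 0 := by
      push_cast
      linear_combination h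
    exact (mul_eq_zero.1 h').resolve_left (by
      rw [Complex.ofReal_eq_zero]; intro h; linarith)
  have hne : ∀ i, l i ≠ 0 := fun i hi => u.ne_zero i (hinj _ (by rw [hu, hi]; simp))
  have hBu : ∀ i, B (u i) x = conj (u.repr x i) := by
    intro i
    conv_lhs => rw [← u.sum_repr x]
    simp only [map_sum, LinearMap.map_smulₛₗ, horth]
    simp
  have hB : B (T x) x = ∑ i, ((l i * Complex.normSq (u.repr x i) : ℝ) : ℂ) := by
    rw [hTx x]
    simp only [map_sum, map_smul, LinearMap.sum_apply, LinearMap.smul_apply, hBu]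
    refine Finset.sum_congr rfl fun i _ => ?_
    rw [Complex.ofReal_mul, Complex.normSq_eq_conj_mul_self]
    simp
    ring
  rw [hB, ← Complex.ofReal_sum, Complex.ofReal_re]
  obtain ⟨i, hi⟩ : ∃ i, u.repr x i ≠ 0 := by
    by_contra! h
    exact hx0 (u.repr.map_eq_zero_iff.1 (Finsupp.ext h))
  have hterm : ∀ i, 0 ≤ l i * Complex.normSq (u.repr x i) := by
    intro i
    by_cases h : l i < 0
    · simp [hneg i h]
    · exact mul_nonneg (not_lt.1 h) (Complex.normSq_nonneg _)
  refine Finset.sum_pos' (fun i _ => hterm i) ⟨i, Finset.mem_univ i, ?_⟩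
  refine lt_of_le_of_ne (hterm i) (Ne.symm (mul_ne_zero (hne i) ?_))
  exact (Complex.normSq_eq_zero).not.2 hi

theorem nonnegEigenspan_sup_eq_top (hsymm : ∀ a b, conj (B b a) = B a b)
    (hpos : ∀ a, a ≠ 0 → 0 < (B a a).re) (T : E →ₗ[ℂ] E)
    (hT : ∀ a b, B (T a) b = B a (T b)) :
    nonnegEigenspan T ⊔ Submodule.span ℂ {x | ∃ l : ℝ, l ≤ 0 ∧ T x = (l : ℂ) • x} = ⊤ := by
  obtain ⟨n, u, l, hu, -⟩ := exists_orthonormal_eigenbasis B hsymm hpos T hT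
  rw [eq_top_iff, ← u.span_eq, Submodule.span_le]
  rintro _ ⟨i, rfl⟩
  obtain h | h := le_total 0 (l i)
  · exact Submodule.mem_sup_left (Submodule.subset_span ⟨l i, h, hu i⟩)
  · exact Submodule.mem_sup_right (Submodule.subset_span ⟨l i, h, hu i⟩)

/-- Translates `★σ = -iλσ` into the eigenvalue equation of the self-adjoint operator `i★`. -/
theorem I_smul_eq_smul_iff (x y : E) (l : ℂ) :
    Complex.I • x = l • y ↔ x = (-(Complex.I * l)) • y := by
  rw [← smul_right_inj (neg_ne_zero.2 Complex.I_ne_zero), smul_smul, smul_smul, neg_mul, neg_mul,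
    Complex.I_mul_I, neg_neg, one_smul]

end Spectral

/-! ### The product of cochains as a bilinear form -/

section Harmonic

variable {V : Type*} [Fintype V] [LinearOrder V]

/-- The bilinear form `(α, β) ↦ (α ∪ β)[M]`. -/
noncomputable def cupPairing (S : TriangulatedSurface V) :
    Cochain S.K 1 →ₗ[ℂ] Cochain S.K 1 →ₗ[ℂ] ℂ :=
  LinearMap.mk₂ ℂ (fun α β => (cup α β).eval S.fundamentalCycle)
    (fun α α' β => by rw [cup_add_left, Cochain.eval_add])
    (fun r α β => by rw [cup_smul_left, Cochain.eval_smul, smul_eq_mul])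
    (fun α β β' => by rw [cup_add_right, Cochain.eval_add])
    (fun r α β => by rw [cup_smul_right, Cochain.eval_smul, smul_eq_mul])

variable (S : TriangulatedSurface V)

theorem cupPairing_apply (α β : Cochain S.K 1) :
    cupPairing S α β = (cup α β).eval S.fundamentalCycle := rfl

theorem cupPairing_swap (α β : Cochain S.K 1) : cupPairing S α β = -cupPairing S β α :=
  cup_eval_swap S α β

theorem cupPairing_coboundary {α : Cochain S.K 1} (hα : coboundary S.K 1 α = 0)
    (f : Cochain S.K 0) : cupPairing S α (coboundary S.K 0 f) = 0 :=
  cup_coboundary_eval S hα f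

theorem cupPairing_star (α β : Cochain S.K 1) :
    cupPairing S (star α) (star β) = conj (cupPairing S α β) := by
  rw [cupPairing_apply, cupPairing_apply, ← Cochain.eval_star]
  congr 1
  funext t
  simp [cup_apply]

theorem coboundary_star {K : AbstractSimplicialComplex V} (j : ℕ) (f : Cochain K j) :
    coboundary K j (star f) = star (coboundary K j f) := by
  funext s
  simp [coboundary]

/-! ### Harmonic cochains -/

namespace CochainInnerProduct

section Complexes

variable {K : AbstractSimplicialComplex V} (ip : CochainInnerProduct K)

theorem eq_zero_of_form_self {j : ℕ} {a : Cochain K j} (h : ip.form j a a = 0) : a = 0 := by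
  by_contra hne
  have := ip.pos j a hne
  simp [h] at this

/-- The Laplace condition is redundant, and `δ*σ = 0` says that `σ` is orthogonal to all
coboundaries. -/
theorem mem_harmonic_iff (σ : Cochain K 1) :
    σ ∈ ip.harmonic ↔
      coboundary K 1 σ = 0 ∧ ∀ f : Cochain K 0, ip.form 1 σ (coboundary K 0 f) = 0 := by
  have hcod : ip.codifferential 0 σ = 0 ↔ ∀ f : Cochain K 0, ip.form 1 σ (coboundary K 0 f) = 0 := by
    constructor
    · intro h f
      rw [← form_codifferential, h]
      simp
    · intro h
      apply ip.eq_zero_of_form_self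
      rw [form_codifferential]
      exact h _
  simp only [harmonic, Submodule.mem_inf, LinearMap.mem_ker, ← hcod]
  refine ⟨fun h => ⟨h.1.2, h.2⟩, fun h => ⟨⟨?_, h.1⟩, h.2⟩⟩
  simp [laplacian, h.1, h.2]

theorem star_mem_harmonic (hreal : ip.IsReal) {σ : Cochain K 1} (h : σ ∈ ip.harmonic) :
    star σ ∈ ip.harmonic := by
  rw [mem_harmonic_iff] at h ⊢
  refine ⟨by rw [coboundary_star, h.1, star_zero], fun f => ?_⟩
  have := hreal σ (coboundary K 0 (star f))
  rwa [h.2, ← coboundary_star, star_star, map_zero] at this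

/-- Every closed `1`-cochain is cohomologous to a harmonic one. -/
theorem exists_sub_coboundary_mem_harmonic {η : Cochain K 1} (hη : coboundary K 1 η = 0) :
    ∃ f : Cochain K 0, η - coboundary K 0 f ∈ ip.harmonic := by
  let R := LinearMap.range (coboundary K 0)
  let B : R →ₗ[ℂ] AntiDual R :=
    { toFun := fun a => (ip.form 1 (a : Cochain K 1)).comp R.subtype
      map_add' := fun a b => by ext; simp
      map_smul' := fun r a => by ext; simp }
  -- Riesz on the exact cochains produces the orthogonal projection `δf` of `η`.
  obtain ⟨⟨_, f, rfl⟩, hr⟩ := (riesz_bijective B (fun a b => ip.conj_symm 1 a b)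
    (fun a ha => ip.pos 1 a fun h => ha (Subtype.ext h))).2 ((ip.form 1 η).comp R.subtype)
  refine ⟨f, (ip.mem_harmonic_iff _).2 ⟨by rw [map_sub, hη, coboundary_coboundary, sub_zero], ?_⟩⟩
  intro h
  have := congrArg (fun φ : AntiDual R => φ ⟨_, h, rfl⟩) hr
  rw [map_sub, LinearMap.sub_apply, sub_eq_zero]
  exact this.symm

theorem eq_zero_of_mem_harmonic_of_exact {σ : Cochain K 1} (h : σ ∈ ip.harmonic)
    {f : Cochain K 0} (hf : σ = coboundary K 0 f) : σ = 0 := by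
  apply ip.eq_zero_of_form_self
  conv_lhs => rw [hf]
  rw [← hf]
  have := ((ip.mem_harmonic_iff σ).1 h).2 f
  rwa [← hf] at this

end Complexes

end CochainInnerProduct

variable (ip : CochainInnerProduct S.K)

theorem form_harmonicStar (σ τ : ip.harmonic) :
    ip.form 1 (harmonicStar S ip σ : Cochain S.K 1) τ = cupPairing S σ (star τ.1) := by
  rw [harmonicStar, LinearMap.comp_apply, ip.form_harmonicProjection]
  exact form_combinatorialStar S ip σ τ

theorem harmonicForm_apply (σ τ : ip.harmonic) : ip.harmonicForm σ τ = ip.form 1 σ.1 τ.1 := rfl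

theorem harmonicForm_conj (σ τ : ip.harmonic) :
    conj (ip.harmonicForm τ σ) = ip.harmonicForm σ τ := ip.conj_symm 1 _ _

theorem harmonicForm_pos (σ : ip.harmonic) (h : σ ≠ 0) : 0 < (ip.harmonicForm σ σ).re :=
  ip.pos 1 _ fun h' => h (Subtype.ext h')

/-- The operator `i ★` on harmonic cochains is self-adjoint. -/
theorem harmonicForm_I_smul_harmonicStar (σ τ : ip.harmonic) :
    ip.harmonicForm ((Complex.I • harmonicStar S ip) σ) τ =
      ip.harmonicForm σ ((Complex.I • harmonicStar S ip) τ) := by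
  have h1 : ∀ σ τ : ip.harmonic, ip.harmonicForm ((Complex.I • harmonicStar S ip) σ) τ =
      Complex.I * cupPairing S σ (star τ.1) := by
    intro σ τ
    rw [LinearMap.smul_apply, map_smul, LinearMap.smul_apply, harmonicForm_apply,
      form_harmonicStar, smul_eq_mul]
  -- The sign from conjugating `i` cancels the one from skew symmetry of the product.
  rw [h1, ← harmonicForm_conj, h1, map_mul, ← cupPairing_star, star_star, Complex.conj_I,
    cupPairing_swap]
  ring

/-- Nondegeneracy of the product on harmonic cochains. -/
theorem harmonicStar_eq_zero (hreal : ip.IsReal) {σ : ip.harmonic}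
    (h : harmonicStar S ip σ = 0) : σ = 0 := by
  have hσ := (ip.mem_harmonic_iff σ.1).1 σ.2
  have hpair : ∀ τ ∈ ip.harmonic, cupPairing S σ.1 τ = 0 := by
    intro τ hτ
    have := form_harmonicStar S ip σ ⟨star τ, ip.star_mem_harmonic hreal hτ⟩
    rw [h, star_star] at this
    simpa using this.symm
  -- Each period of `σ` is its product with a Poincaré dual, which may be replaced by its harmonic
  -- representative; hence all periods vanish.
  obtain ⟨f, hf⟩ := exists_eq_coboundary_of_periods_eq_zero S.connected σ.1 fun z hz => by
    obtain ⟨η, hη, hdual⟩ := exists_isPoincareDual S z hz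
    obtain ⟨f, hf⟩ := ip.exists_sub_coboundary_mem_harmonic hη
    have := hpair _ hf
    rw [map_sub, cupPairing_coboundary S hσ.1, sub_zero] at this
    rw [hdual _ hσ.1]
    exact this
  exact Subtype.ext (ip.eq_zero_of_mem_harmonic_of_exact σ.2 hf)

/-! ### Holomorphic cochains -/

theorem holomorphicCochains_eq_map : holomorphicCochains S ip =
    (nonnegEigenspan (Complex.I • harmonicStar S ip)).map ip.harmonic.subtype := by
  rw [nonnegEigenspan, Submodule.map_span, holomorphicCochains]
  congr 1
  ext σ
  have key : ∀ (τ : ip.harmonic) (l : ℝ), (Complex.I • harmonicStar S ip) τ = (l : ℂ) • τ ↔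
      (harmonicStar S ip τ : Cochain S.K 1) = (-(Complex.I * l)) • τ.1 := by
    intro τ l
    rw [LinearMap.smul_apply, ← Submodule.coe_smul, Subtype.coe_inj, I_smul_eq_smul_iff]
  constructor
  · rintro ⟨h, l, hl, hσ⟩
    exact ⟨⟨σ, h⟩, ⟨l, hl, (key _ _).2 hσ⟩, rfl⟩
  · rintro ⟨τ, ⟨l, hl, hτ⟩, rfl⟩
    exact ⟨τ.2, l, hl, (key _ _).1 hτ⟩

theorem holomorphicCochains_le_harmonic : holomorphicCochains S ip ≤ ip.harmonic := by
  rw [holomorphicCochains_eq_map]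
  exact Submodule.map_subtype_le _ _

theorem coboundary_eq_zero_of_mem_holomorphicCochains {σ : Cochain S.K 1}
    (h : σ ∈ holomorphicCochains S ip) : coboundary S.K 1 σ = 0 :=
  ((ip.mem_harmonic_iff σ).1 (holomorphicCochains_le_harmonic S ip h)).1

/-- The product of two holomorphic cochains vanishes. -/
theorem cupPairing_eq_zero_of_mem_holomorphicCochains (hreal : ip.IsReal) {σ τ : Cochain S.K 1}
    (hσ : σ ∈ holomorphicCochains S ip) (hτ : τ ∈ holomorphicCochains S ip) :
    cupPairing S σ τ = 0 := by
  have key : ∀ (σ τ : Cochain S.K 1) (hσ : σ ∈ ip.harmonic) (_ : τ ∈ ip.harmonic) (l : ℝ),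
      (harmonicStar S ip ⟨σ, hσ⟩ : Cochain S.K 1) = (-(Complex.I * l)) • σ →
      cupPairing S σ τ = -(Complex.I * l) * ip.form 1 σ (star τ) := by
    intro σ τ hσ hτ l h
    have := form_harmonicStar S ip ⟨σ, hσ⟩ ⟨star τ, ip.star_mem_harmonic hreal hτ⟩
    rw [h, star_star, map_smul] at this
    exact this.symm
  have hgen : ∀ σ ∈ {σ | ∃ (h : σ ∈ ip.harmonic) (l : ℝ), 0 ≤ l ∧
      (harmonicStar S ip ⟨σ, h⟩ : Cochain S.K 1) = (-(Complex.I * l)) • σ},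
      holomorphicCochains S ip ≤ LinearMap.ker (cupPairing S σ) := by
    rintro σ ⟨hσ, l, hl, hσl⟩
    refine Submodule.span_le.2 ?_
    rintro τ ⟨hτ, m, hm, hτm⟩
    have h1 := key σ τ hσ hτ l hσl
    have h2 := key τ σ hτ hσ m hτm
    have h3 : ip.form 1 τ (star σ) = ip.form 1 σ (star τ) := by
      rw [← ip.conj_symm, ← hreal, star_star]
    -- Moving `★` onto either factor computes the same product up to sign. As `l, m ≥ 0`, either `l
    -- = 0` or `⟨σ, τ̄⟩ = 0`, and the product vanishes in both cases.
    have h4 : ((l + m : ℝ) : ℂ) * (Complex.I * ip.form 1 σ (star τ)) = 0 := by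
      push_cast
      rw [h3] at h2
      linear_combination h1 + h2 - cupPairing_swap S σ τ
    rw [SetLike.mem_coe, LinearMap.mem_ker, h1]
    obtain h | h := mul_eq_zero.1 h4
    · have hl0 : l = 0 := by
        have := Complex.ofReal_eq_zero.1 h
        linarith
      simp [hl0]
    · linear_combination (-(l : ℂ)) * h
  have hle : holomorphicCochains S ip ≤ LinearMap.ker ((cupPairing S).flip τ) :=
    Submodule.span_le.2 fun σ' hσ' => hgen σ' hσ' hτ
  exact hle hσ

/-- Positivity of the hermitian form `i (σ ∪ σ̄)[M]` on holomorphic cochains. -/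
theorem re_I_mul_cupPairing_star_pos (hreal : ip.IsReal) {σ : Cochain S.K 1}
    (hσ : σ ∈ holomorphicCochains S ip) (h0 : σ ≠ 0) :
    0 < (Complex.I * cupPairing S σ (star σ)).re := by
  rw [holomorphicCochains_eq_map] at hσ
  obtain ⟨τ, hτ, rfl⟩ := hσ
  have h := re_pos_of_mem_nonnegEigenspan ip.harmonicForm (harmonicForm_conj S ip)
    (harmonicForm_pos S ip) _ (harmonicForm_I_smul_harmonicStar S ip) (fun x hx => by
      refine harmonicStar_eq_zero S ip hreal ?_
      rw [LinearMap.smul_apply] at hx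
      exact (smul_eq_zero.1 hx).resolve_left Complex.I_ne_zero) hτ (fun h => h0 (by simp [h]))
  rwa [LinearMap.smul_apply, map_smul, LinearMap.smul_apply, harmonicForm_apply,
    form_harmonicStar, smul_eq_mul] at h

/-- The operator `★` commutes with conjugation while `i` changes sign, so `σ̄` has eigenvalue `-l`
for `i★`. -/
theorem star_mem_holomorphicCochains (hreal : ip.IsReal) {σ : ip.harmonic} {l : ℝ} (hl : l ≤ 0)
    (h : (Complex.I • harmonicStar S ip) σ = (l : ℂ) • σ) :
    star σ.1 ∈ holomorphicCochains S ip := by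
  have hs : harmonicStar S ip σ = (-(Complex.I * l)) • σ :=
    (I_smul_eq_smul_iff (harmonicStar S ip σ) σ (l : ℂ)).1 h
  let τ : ip.harmonic := ⟨star σ.1, ip.star_mem_harmonic hreal σ.2⟩
  refine Submodule.subset_span ⟨τ.2, -l, by linarith, ?_⟩
  suffices harmonicStar S ip τ = (-(Complex.I * (-l : ℝ))) • τ from congrArg Subtype.val this
  apply ip.harmonicForm_bijective.1
  ext ρ
  have h1 := form_harmonicStar S ip σ ⟨star ρ.1, ip.star_mem_harmonic hreal ρ.2⟩
  have h2 := hreal σ.1 (star ρ.1)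
  rw [harmonicForm_apply, form_harmonicStar, map_smul, LinearMap.smul_apply, harmonicForm_apply,
    cupPairing_star, smul_eq_mul]
  rw [hs, Submodule.coe_smul, map_smul, LinearMap.smul_apply, star_star, smul_eq_mul] at h1
  rw [star_star] at h2
  rw [← h1, h2]
  simp

/-- The decomposition of harmonic cochains into holomorphic and antiholomorphic ones. -/
theorem exists_eq_add_star (hreal : ip.IsReal) {τ : Cochain S.K 1} (hτ : τ ∈ ip.harmonic) :
    ∃ τ₁ ∈ holomorphicCochains S ip, ∃ τ₂ ∈ holomorphicCochains S ip, τ = τ₁ + star τ₂ := by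
  have h := nonnegEigenspan_sup_eq_top ip.harmonicForm (harmonicForm_conj S ip)
    (harmonicForm_pos S ip) _ (harmonicForm_I_smul_harmonicStar S ip)
  obtain ⟨x, hx, y, hy, hxy⟩ := Submodule.mem_sup.1
    (h ▸ Submodule.mem_top : (⟨τ, hτ⟩ : ip.harmonic) ∈ _)
  refine ⟨x.1, ?_, star y.1, ?_, ?_⟩
  · rw [holomorphicCochains_eq_map]
    exact ⟨x, hx, rfl⟩
  · refine Submodule.span_induction (p := fun z _ => star z.1 ∈ holomorphicCochains S ip)
      ?_ ?_ ?_ ?_ hy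
    · rintro z ⟨l, hl, hz⟩
      exact star_mem_holomorphicCochains S ip hreal hl hz
    · simp
    · intro z w _ _ hz hw
      rw [Submodule.coe_add, star_add]
      exact Submodule.add_mem _ hz hw
    · intro r z _ hz
      rw [Submodule.coe_smul, star_smul]
      exact Submodule.smul_mem _ _ hz
  · rw [star_star]
    exact (congrArg Subtype.val hxy).symm

end Harmonic

/-! ### Periods -/

section Periods

variable {V : Type*} [Fintype V] [LinearOrder V] (S : TriangulatedSurface V)

variable {S} in
/-- Duals of a canonical homology basis, with their periods. -/
theorem IsCanonicalHomologyBasis.exists_duals {g : ℕ} {a b : Fin g → Chain S.K 1}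
    (hab : IsCanonicalHomologyBasis S a b) :
    ∃ ηa ηb : Fin g → Cochain S.K 1, (∀ i, IsPoincareDual S (ηa i) (a i)) ∧
      (∀ i, IsPoincareDual S (ηb i) (b i)) ∧
      (∀ i j, (ηa i).eval (a j) = 0) ∧ (∀ i j, (ηa i).eval (b j) = if i = j then 1 else 0) ∧
      (∀ i j, (ηb i).eval (a j) = if i = j then -1 else 0) ∧ ∀ i j, (ηb i).eval (b j) = 0 := by
  choose ηa ha using fun i => exists_isPoincareDual S (a i) (hab.isHomologyBasis.1 (Sum.inl i))
  choose ηb hb using fun i => exists_isPoincareDual S (b i) (hab.isHomologyBasis.1 (Sum.inr i))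
  refine ⟨ηa, ηb, ha, hb, fun i j => ?_, fun i j => ?_, fun i j => ?_, fun i j => ?_⟩
  · rw [(ha j).2 _ (ha i).1, hab.inter_aa i j _ _ (ha i) (ha j), Int.cast_zero]
  · rw [(hb j).2 _ (ha i).1, hab.inter_ab i j _ _ (ha i) (hb j)]
    push_cast; rfl
  · rw [(ha j).2 _ (hb i).1, cup_eval_swap, hab.inter_ab j i _ _ (ha j) (hb i)]
    by_cases h : i = j
    · simp [h]
    · simp [h, Ne.symm h]
  · rw [(hb j).2 _ (hb i).1, hab.inter_bb i j _ _ (hb i) (hb j), Int.cast_zero]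

variable {S} in
-- Every cycle is a combination of basis cycles plus a boundary, and closed cochains vanish on
-- boundaries.
theorem IsCanonicalHomologyBasis.exists_eq_coboundary {g : ℕ} {a b : Fin g → Chain S.K 1}
    (hab : IsCanonicalHomologyBasis S a b) {α : Cochain S.K 1} (hα : coboundary S.K 1 α = 0)
    (ha : ∀ i, α.eval (a i) = 0) (hb : ∀ i, α.eval (b i) = 0) :
    ∃ f : Cochain S.K 0, α = coboundary S.K 0 f := by
  refine exists_eq_coboundary_of_periods_eq_zero S.connected α fun z hz => ?_
  obtain ⟨n, ⟨d, hd⟩, -⟩ := hab.isHomologyBasis.2 z hz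
  have h := Cochain.eval_coboundary α d
  rw [hα, ← hd, Cochain.eval_sub_right, Cochain.eval_sum_right, Fintype.sum_sum_type] at h
  simp only [Cochain.eval_zsmul_right, Sum.elim_inl, Sum.elim_inr, ha, hb] at h
  simpa [Cochain.eval] using h.symm

variable {S} in
/-- Riemann's bilinear relation. -/
theorem IsCanonicalHomologyBasis.cupPairing_eq {g : ℕ} {a b : Fin g → Chain S.K 1}
    (hab : IsCanonicalHomologyBasis S a b) {α β : Cochain S.K 1} (hα : coboundary S.K 1 α = 0)
    (hβ : coboundary S.K 1 β = 0) :
    cupPairing S α β = ∑ k, (α.eval (a k) * β.eval (b k) - α.eval (b k) * β.eval (a k)) := by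
  obtain ⟨ηa, ηb, ha, hb, haa, hab', hba, hbb⟩ := hab.exists_duals
  -- This combination of duals has the periods of `β`; the minus sign reflects `bₖ · aₖ = -1`.
  set β' : Cochain S.K 1 := ∑ k, (β.eval (b k) • ηa k - β.eval (a k) • ηb k) with hβ'
  have hcl : coboundary S.K 1 (β - β') = 0 := by
    rw [map_sub, hβ, hβ', map_sum, zero_sub, neg_eq_zero]
    refine Finset.sum_eq_zero fun k _ => ?_
    rw [map_sub, map_smul, map_smul, (ha k).1, (hb k).1]
    simp
  obtain ⟨f, hf⟩ := hab.exists_eq_coboundary hcl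
    (fun i => by
      rw [Cochain.eval_sub, hβ', Cochain.eval_sum]
      simp [Cochain.eval_sub, Cochain.eval_smul, haa, hba])
    (fun i => by
      rw [Cochain.eval_sub, hβ', Cochain.eval_sum]
      simp [Cochain.eval_sub, Cochain.eval_smul, hab', hbb])
  have h := cupPairing_coboundary S hα f
  rw [← hf, map_sub, sub_eq_zero] at h
  rw [h, hβ', map_sum]
  refine Finset.sum_congr rfl fun k _ => ?_
  rw [map_sub, map_smul, map_smul, cupPairing_apply, cupPairing_apply, ← (ha k).2 α hα,
    ← (hb k).2 α hα, smul_eq_mul, smul_eq_mul]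
  ring

variable {S} in
theorem IsCanonicalHomologyBasis.exists_closed {g : ℕ} {a b : Fin g → Chain S.K 1}
    (hab : IsCanonicalHomologyBasis S a b) (w : Fin g → ℂ) :
    ∃ τ : Cochain S.K 1, coboundary S.K 1 τ = 0 ∧ (∀ i, τ.eval (a i) = 0) ∧
      ∀ i, τ.eval (b i) = w i := by
  obtain ⟨ηa, ηb, ha, -, haa, hab', -, -⟩ := hab.exists_duals
  refine ⟨∑ k, w k • ηa k, ?_, fun i => ?_, fun i => ?_⟩
  · rw [map_sum]
    exact Finset.sum_eq_zero fun k _ => by rw [map_smul, (ha k).1, smul_zero]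
  · simp [Cochain.eval_sum, Cochain.eval_smul, haa]
  · simp [Cochain.eval_sum, Cochain.eval_smul, hab']

theorem Cochain.eval_coboundary_of_cycle {K : AbstractSimplicialComplex V} (f : Cochain K 0)
    {c : Chain K 1} (hc : boundary K 0 c = 0) : (coboundary K 0 f).eval c = 0 := by
  rw [Cochain.eval_coboundary, hc]
  simp [Cochain.eval]

variable (ip : CochainInnerProduct S.K)

/-- The `A`-periods of the holomorphic cochains. -/
noncomputable def aPeriodMap {g : ℕ} (a : Fin g → Chain S.K 1) :
    holomorphicCochains S ip →ₗ[ℂ] (Fin g → ℂ) where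
  toFun σ j := σ.1.eval (a j)
  map_add' _ _ := funext fun _ => Cochain.eval_add _ _ _
  map_smul' _ _ := funext fun _ => Cochain.eval_smul _ _ _

theorem aPeriodMap_apply {g : ℕ} (a : Fin g → Chain S.K 1) (σ : holomorphicCochains S ip)
    (j : Fin g) : aPeriodMap S ip a σ j = σ.1.eval (a j) := rfl

variable {g : ℕ} {a b : Fin g → Chain S.K 1}

/-! ### The A-period isomorphism -/

theorem re_I_mul_sum_periods_pos (hreal : ip.IsReal) (hab : IsCanonicalHomologyBasis S a b)
    {σ : Cochain S.K 1} (hσ : σ ∈ holomorphicCochains S ip) (h0 : σ ≠ 0) :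
    0 < (Complex.I * ∑ k, (σ.eval (a k) * conj (σ.eval (b k)) -
      σ.eval (b k) * conj (σ.eval (a k)))).re := by
  have h := re_I_mul_cupPairing_star_pos S ip hreal hσ h0
  have hcl := coboundary_eq_zero_of_mem_holomorphicCochains S ip hσ
  rw [hab.cupPairing_eq hcl (by rw [coboundary_star, hcl, star_zero])] at h
  simpa only [Cochain.eval_star] using h

theorem eq_zero_of_aPeriods_eq_zero (hreal : ip.IsReal) (hab : IsCanonicalHomologyBasis S a b)
    {σ : Cochain S.K 1} (hσ : σ ∈ holomorphicCochains S ip) (h : ∀ j, σ.eval (a j) = 0) :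
    σ = 0 := by
  by_contra h0
  have := re_I_mul_sum_periods_pos S ip hreal hab hσ h0
  simp [h] at this

/-- Injectivity is positivity. For surjectivity, a functional `f` vanishing on all A-period vectors
is realized as the product with a harmonic `τ` having no A-periods, and `τ` is shown to be zero. -/
theorem aPeriodMap_bijective (hreal : ip.IsReal) (hab : IsCanonicalHomologyBasis S a b) :
    Function.Bijective (aPeriodMap S ip a) := by
  constructor
  · refine (injective_iff_map_eq_zero _).2 fun σ hσ => Subtype.ext ?_
    exact eq_zero_of_aPeriods_eq_zero S ip hreal hab σ.2 fun j => congrFun hσ j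
  · intro y
    by_contra hy
    obtain ⟨f, hfy, hf⟩ := Submodule.exists_le_ker_of_notMem
      (p := LinearMap.range (aPeriodMap S ip a)) hy
    have hfsum : ∀ z : Fin g → ℂ, f z = ∑ k, z k * f (Pi.single k 1) := by
      intro z
      rw [LinearMap.pi_apply_eq_sum_univ f]
      refine Finset.sum_congr rfl fun k _ => ?_
      rw [smul_eq_mul]
      congr 2
      funext j
      simp [Pi.single_apply, eq_comm]
    -- With these B-periods the bilinear relation reads `(σ ∪ τ)[M] = f(σ(a₁), …, σ(a_g))`.
    obtain ⟨τ₀, hτ₀, hτa, hτb⟩ := hab.exists_closed fun k => f (Pi.single k 1)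
    obtain ⟨φ, hφ⟩ := ip.exists_sub_coboundary_mem_harmonic hτ₀
    have hper : ∀ c, boundary S.K 0 c = 0 → (τ₀ - coboundary S.K 0 φ).eval c = τ₀.eval c :=
      fun c hc => by rw [Cochain.eval_sub, Cochain.eval_coboundary_of_cycle _ hc, sub_zero]
    have hcl : coboundary S.K 1 (τ₀ - coboundary S.K 0 φ) = 0 := by
      rw [map_sub, hτ₀, coboundary_coboundary, sub_zero]
    have hτa' : ∀ i, (τ₀ - coboundary S.K 0 φ).eval (a i) = 0 := fun i => by
      exact (hper _ (hab.isHomologyBasis.1 (Sum.inl i))).trans (hτa i)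
    have hτb' : ∀ i, (τ₀ - coboundary S.K 0 φ).eval (b i) = f (Pi.single i 1) := fun i => by
      exact (hper _ (hab.isHomologyBasis.1 (Sum.inr i))).trans (hτb i)
    generalize τ₀ - coboundary S.K 0 φ = τ at hφ hcl hτa' hτb'
    have horth : ∀ σ ∈ holomorphicCochains S ip, cupPairing S σ τ = 0 := by
      intro σ hσ
      rw [hab.cupPairing_eq (coboundary_eq_zero_of_mem_holomorphicCochains S ip hσ) hcl]
      simp only [hτa', hτb', mul_zero, sub_zero]
      rw [← hfsum fun k => σ.eval (a k)]
      exact hf ⟨⟨σ, hσ⟩, rfl⟩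
    obtain ⟨τ₁, h₁, τ₂, h₂, hτ⟩ := exists_eq_add_star S ip hreal hφ
    -- Pairing `τ₂` with `τ = τ₁ + τ̄₂` gives `(τ₂ ∪ τ̄₂)[M] = 0`, against positivity. So `τ` is
    -- holomorphic without A-periods, hence zero.
    have h20 : τ₂ = 0 := by
      by_contra h0
      have hpos := re_I_mul_cupPairing_star_pos S ip hreal h₂ h0
      have := horth τ₂ h₂
      rw [hτ, map_add, cupPairing_eq_zero_of_mem_holomorphicCochains S ip hreal h₂ h₁,
        zero_add] at this
      simp [this] at hpos
    rw [h20, star_zero, add_zero] at hτ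
    have hτ0 : τ = 0 := eq_zero_of_aPeriods_eq_zero S ip hreal hab (hτ ▸ h₁) hτa'
    apply hfy
    rw [hfsum]
    refine Finset.sum_eq_zero fun k _ => ?_
    rw [← hτb', hτ0]
    simp [Cochain.eval]

theorem IsCanonicalHolomorphicBasis.mem {S : TriangulatedSurface V}
    {ip : CochainInnerProduct S.K} {a : Fin g → Chain S.K 1} {σ : Fin g → Cochain S.K 1}
    (hσ : IsCanonicalHolomorphicBasis S ip a σ) (i : Fin g) : σ i ∈ holomorphicCochains S ip :=
  hσ.span_eq ▸ Submodule.subset_span ⟨i, rfl⟩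

theorem existsUnique_isCanonicalHolomorphicBasis (hreal : ip.IsReal)
    (hab : IsCanonicalHomologyBasis S a b) :
    ∃! σ : Fin g → Cochain S.K 1, IsCanonicalHolomorphicBasis S ip a σ := by
  have hbij := aPeriodMap_bijective S ip hreal hab
  let e := LinearEquiv.ofBijective (aPeriodMap S ip a) hbij
  let B : Module.Basis (Fin g) ℂ (holomorphicCochains S ip) := Module.Basis.ofEquivFun e
  have hB : ∀ i, aPeriodMap S ip a (B i) = Pi.single i 1 := fun i => by
    have : e (B i) = Pi.single i 1 := by simp [B]
    exact this
  refine ⟨fun i => (B i : Cochain S.K 1), ⟨?_, ?_, fun i j => ?_⟩, fun σ hσ => funext fun i => ?_⟩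
  · exact B.linearIndependent.map' (holomorphicCochains S ip).subtype (Submodule.ker_subtype _)
  · have h := congrArg (Submodule.map (holomorphicCochains S ip).subtype) B.span_eq
    rw [Submodule.map_span, Submodule.map_subtype_top, ← Set.range_comp] at h
    exact h
  · rw [← aPeriodMap_apply, hB, Pi.single_apply]
    simp [eq_comm]
  · have : (⟨σ i, hσ.mem i⟩ : holomorphicCochains S ip) = B i := hbij.1 (by
      rw [hB]
      funext j
      rw [aPeriodMap_apply, hσ.aPeriods, Pi.single_apply]
      simp [eq_comm])
    exact congrArg Subtype.val this

/-! ### The period matrix -/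

/-- The bilinear relation turns `(σᵢ ∪ σⱼ)[M] = 0` into `πⱼᵢ - πᵢⱼ = 0`. -/
theorem periodMatrix_isSymm (hreal : ip.IsReal) (hab : IsCanonicalHomologyBasis S a b)
    {σ : Fin g → Cochain S.K 1} (hσ : IsCanonicalHolomorphicBasis S ip a σ) :
    (periodMatrix b σ).IsSymm := by
  refine Matrix.IsSymm.ext fun i j => ?_
  have h := cupPairing_eq_zero_of_mem_holomorphicCochains S ip hreal (hσ.mem i) (hσ.mem j)
  rw [hab.cupPairing_eq (coboundary_eq_zero_of_mem_holomorphicCochains S ip (hσ.mem i))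
    (coboundary_eq_zero_of_mem_holomorphicCochains S ip (hσ.mem j))] at h
  simp only [hσ.aPeriods, Finset.sum_sub_distrib, ite_mul, mul_ite, one_mul, mul_one, zero_mul,
    mul_zero, Finset.sum_ite_eq, Finset.mem_univ, if_true] at h
  exact sub_eq_zero.1 h

theorem im_periodMatrix_posDef (hreal : ip.IsReal) (hab : IsCanonicalHomologyBasis S a b)
    {σ : Fin g → Cochain S.K 1} (hσ : IsCanonicalHolomorphicBasis S ip a σ) :
    ((periodMatrix b σ).map Complex.im).PosDef := by
  refine Matrix.PosDef.of_dotProduct_mulVec_pos ?_ fun x hx => ?_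
  · refine Matrix.IsHermitian.ext fun i j => ?_
    have h := (periodMatrix_isSymm S ip hreal hab hσ).apply i j
    simp [h]
  · have hmem : ∑ i, (x i : ℂ) • σ i ∈ holomorphicCochains S ip :=
      Submodule.sum_mem _ fun i _ => Submodule.smul_mem _ _ (hσ.mem i)
    have hne : ∑ i, (x i : ℂ) • σ i ≠ 0 := fun h => hx (funext fun i =>
      Complex.ofReal_eq_zero.1 (Fintype.linearIndependent_iff.1 hσ.linearIndependent _ h i))
    have h := re_I_mul_sum_periods_pos S ip hreal hab hmem hne
    have ha : ∀ k, (∑ i, (x i : ℂ) • σ i).eval (a k) = x k := fun k => by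
      simp only [Cochain.eval_sum, Cochain.eval_smul, hσ.aPeriods]
      simp
    have hb : ∀ k, ((∑ i, (x i : ℂ) • σ i).eval (b k)).im =
        ∑ i, x i * ((periodMatrix b σ).map Complex.im) i k := fun k => by
      simp only [Cochain.eval_sum, Cochain.eval_smul, periodMatrix]
      simp
    -- The A-periods `xₖ` are real, so each term is `i xₖ (z̄ - z) = 2 xₖ Im z` with `z` the
    -- B-period.
    have hre : (Complex.I * ∑ k, ((∑ i, (x i : ℂ) • σ i).eval (a k) *
        conj ((∑ i, (x i : ℂ) • σ i).eval (b k)) - (∑ i, (x i : ℂ) • σ i).eval (b k) *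
        conj ((∑ i, (x i : ℂ) • σ i).eval (a k)))).re =
        2 * ∑ k, x k * ((∑ i, (x i : ℂ) • σ i).eval (b k)).im := by
      rw [Complex.I_mul_re, Complex.im_sum, ← Finset.sum_neg_distrib, Finset.mul_sum]
      refine Finset.sum_congr rfl fun k _ => ?_
      rw [ha, Complex.conj_ofReal]
      generalize (∑ i, (x i : ℂ) • σ i).eval (b k) = z
      simp
      ring
    rw [hre] at h
    have hgoal : star x ⬝ᵥ ((periodMatrix b σ).map Complex.im).mulVec x =
        ∑ k, x k * ((∑ i, (x i : ℂ) • σ i).eval (b k)).im := by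
      rw [Matrix.dotProduct_mulVec, dotProduct]
      refine Finset.sum_congr rfl fun k _ => ?_
      rw [hb, mul_comm]
      simp [Matrix.vecMul, dotProduct]
    rw [hgoal]
    linarith

end Periods

/-- For every cochain inner product on a triangulated closed oriented surface and every canonical
homology basis, the canonical basis of the holomorphic `1`-cochains exists and is unique, its period
matrix `Π` is symmetric, and `Im Π` is positive definite. -/
theorem mainTheorem10 {V : Type*} [Fintype V] [LinearOrder V] (S : TriangulatedSurface V)
    (ip : CochainInnerProduct S.K) (hreal : ip.IsReal) {g : ℕ} (a b : Fin g → Chain S.K 1)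
    (hab : IsCanonicalHomologyBasis S a b) :
    (∃! σ : Fin g → Cochain S.K 1, IsCanonicalHolomorphicBasis S ip a σ) ∧
      ∀ σ : Fin g → Cochain S.K 1, IsCanonicalHolomorphicBasis S ip a σ →
        (periodMatrix b σ).IsSymm ∧ ((periodMatrix b σ).map Complex.im).PosDef :=
  ⟨existsUnique_isCanonicalHolomorphicBasis S ip hreal hab, fun _ hσ =>
    ⟨periodMatrix_isSymm S ip hreal hab hσ, im_periodMatrix_posDef S ip hreal hab hσ⟩⟩
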